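/- Words are written over the alphabet $\{0,1\}$. For finite words $u,w$, let $\binom{u}{w}$ be the number of times $w$ occurs as a (scattered) subword of $u$. For $k\ge 1$, two words $u,v$ are $k$-binomially equivalent, $u\sim_k v$, if $\binom{u}{x}=\binom{v}{x}$ for all words $x$ of length at most $k$. For an infinite word $\mathbf{x}$ let $\mathrm{Fac}_n(\mathbf{x})$ be its set of factors of length $n$, let $\mathsf{p}_{\mathbf{x}}(n)=\#\mathrm{Fac}_n(\mathbf{x})$ be its factor complexity, and let $\mathsf{b}^{(k)}_{\mathbf{x}}(n)=\#(\mathrm{Fac}_n(\mathbf{x})/{\sim_k})$ be its $k$-binomial complexity. For $\mathsf{f},\mathsf{g}\colon\mathbb{N}\to\mathbb{N}$ write $\mathsf{f}\prec\mathsf{g}$ if $\mathsf{f}(n)<\mathsf{g}(n)$ for infinitely many $n$. An infinite word $\mathbf{s}$ over $\{0,1\}$ is Sturmian if $\mathsf{p}_{\mathbf{s}}(n)=n+1$ for all $n\ge 0$. An infinite word is morphic if it is the image, under a letter-to-letter coding, of a word $f^\omega(a)=\lim_n f^n(a)$, where $f$ is an endomorphism of $A^*$ for a finite alphabet $A$ that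 is prolongable on the letter $a\in A$ (that is, $f(a)=au$ with $f^n(u)$ non-empty for all $n\ge 0$). Let $\varphi\colon 0\mapsto 01,\ 1\mapsto 10$ be the Thue--Morse morphism, and let $\mathbf{f}=0100101001001\cdots$ be the Fibonacci word, the fixed point of $0\mapsto 01,\ 1\mapsto 0$. Theorem. For every Sturmian word $\mathbf{s}$ and every $k\ge 0$, the word $\mathbf{s}_k:=\varphi^k(\mathbf{s})$ satisfies \[\mathsf{b}^{(1)}_{\mathbf{s}_k}\prec\mathsf{b}^{(2)}_{\mathbf{s}_k}\prec\cdots\prec\mathsf{b}^{(k+1)}_{\mathbf{s}_k}\prec\mathsf{b}^{(k+2)}_{\mathbf{s}_k}=\mathsf{p}_{\mathbf{s}_k}.\] In particular, the Fibonacci word $\mathbf{f}$ is Sturmian, and for every $k\ge 0$ the word $\varphi^k(\mathbf{f})$ is morphic and satisfies this chain. Consequently, for every $\ell\ge 1$ there is a morphic word $\mathbf{w}$ over $\{0,1\}$ such that $\mathsf{b}^{(1)}_{\mathbf{w}}\prec\mathsf{b}^{(2)}_{\mathbf{w}}\prec\cdots\prec\mathsf{b}^{(\ell)}_{\mathbf{w}}=\mathsf{p}_{\mathbf{w}}$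 (for $\ell=1$ this reads $\mathsf{b}^{(1)}_{\mathbf{w}}=\mathsf{p}_{\mathbf{w}}$). -/

import Mathlib

/-! Finite words over `A` are lists, (right-)infinite words over `A` are functions `ℕ → A`. -/

namespace BinomialWords

/-- The binomial coefficient of words: the number of times `w` occurs as a (scattered) subword
of `u`. The list `u.sublists'` contains, for every set of positions of `u`, the subword of `u`
read at these positions, so that `w` is counted with multiplicity. -/
def binom {A : Type*} [DecidableEq A] (u w : List A) : ℕ := u.sublists'.count w

/-- The `k`-binomial equivalence: `u ∼ₖ v` when all binomial coefficients with respect to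
words of length at most `k` agree. -/
def binomialSetoid (A : Type*) [DecidableEq A] (k : ℕ) : Setoid (List A) where
  r u v := ∀ x : List A, x.length ≤ k → binom u x = binom v x
  iseqv :=
    { refl := fun _ _ _ => rfl
      symm := fun h x hx => (h x hx).symm
      trans := fun h₁ h₂ x hx => (h₁ x hx).trans (h₂ x hx) }

/-- The factor `x i, x (i+1), …, x (i+n-1)` of the infinite word `x`. -/
def factorAt {A : Type*} (x : ℕ → A) (i n : ℕ) : List A := (List.range n).map fun j => x (i + j)

/-- The set of factors of length `n` of the infinite word `x`. -/
def factors {A : Type*} (x : ℕ → A) (n : ℕ) : Set (List A) := Set.range fun i => factorAt x i n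

/-- The factor complexity of an infinite word (over a finite alphabet). -/
noncomputable def factorComplexity {A : Type*} (x : ℕ → A) (n : ℕ) : ℕ := (factors x n).ncard

/-- The `k`-binomial complexity of an infinite word (over a finite alphabet): the number of
`k`-binomial equivalence classes of its factors of length `n`. -/
noncomputable def binomialComplexity {A : Type*} [DecidableEq A] (k : ℕ) (x : ℕ → A) (n : ℕ) : ℕ :=
  ((fun u : List A => (Quotient.mk (binomialSetoid A k) u)) '' factors x n).ncard

/-- `f ≺ g`: the relation `f n < g n` holds for infinitely many `n`. -/
def InfinitelyOftenLT (f g : ℕ → ℕ) : Prop := {n : ℕ | f n < g n}.Infinite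

infix:50 " ≺ " => InfinitelyOftenLT

/-- The chain `b⁽¹⁾ ≺ b⁽²⁾ ≺ ⋯ ≺ b⁽ˡ⁾ = p` for the binomial complexities `b⁽ʲ⁾` and the factor
complexity `p` of the infinite word `x`. -/
def ComplexityChain {A : Type*} [DecidableEq A] (l : ℕ) (x : ℕ → A) : Prop :=
  (∀ j : ℕ, 1 ≤ j → j < l → binomialComplexity j x ≺ binomialComplexity (j + 1) x) ∧
    binomialComplexity l x = factorComplexity x

/-- An infinite binary word is Sturmian when it has `n + 1` factors of length `n` for all `n`. -/
def IsSturmian (s : ℕ → Fin 2) : Prop := ∀ n : ℕ, factorComplexity s n = n + 1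

/-- The image of a finite word under the morphism `A* → B*` with the values `f` on letters. -/
def mapWord {A B : Type*} (f : A → List B) (u : List A) : List B := u.flatMap f

/-- The image of an infinite word under a non-erasing endomorphism `f` of `A*`: its `n`-th letter
is the `n`-th letter of the image of the prefix of length `n + 1`, which has length `≥ n + 1`
(the default value of `getD` is never used, see `prefix_image`). -/
def image {A : Type*} (f : A → List A) (x : ℕ → A) (n : ℕ) : A :=
  (mapWord f (factorAt x 0 (n + 1))).getD n (x 0)

/-- The endomorphism `f` of `A*` is prolongable on the letter `a`: `f a = a u` where
`fⁿ u` is non-empty for all `n`. -/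
def Prolongable {A : Type*} (f : A → List A) (a : A) : Prop :=
  ∃ u : List A, f a = a :: u ∧ ∀ n : ℕ, (mapWord f)^[n] u ≠ []

/-- The infinite word `f^ω a`, the limit of the words `fⁿ a`, for an endomorphism `f` prolongable
on `a`: its `n`-th letter is the `n`-th letter of `fⁿ a`, which has length `≥ n + 1`
(the default value of `getD` is never used, see `prefix_limitWord`). -/
def limitWord {A : Type*} (f : A → List A) (a : A) (n : ℕ) : A :=
  ((mapWord f)^[n] [a]).getD n a

/-- An infinite word is morphic when it is the image, under a coding (a letter-to-letter map), of
the word `f^ω a` for some endomorphism `f` of the free monoid over a finite alphabet, prolongable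
on the letter `a`. -/
def IsMorphic {B : Type*} (x : ℕ → B) : Prop :=
  ∃ (A : Type) (_ : Fintype A) (f : A → List A) (a : A) (τ : A → B),
    Prolongable f a ∧ x = fun n => τ (limitWord f a n)

/-- The Thue–Morse morphism `0 ↦ 01`, `1 ↦ 10`. -/
def thueMorse : Fin 2 → List (Fin 2) := ![[0, 1], [1, 0]]

/-- The Fibonacci morphism `0 ↦ 01`, `1 ↦ 0`. -/
def fibonacci : Fin 2 → List (Fin 2) := ![[0, 1], [0]]

/-- The Fibonacci word `0100101001001⋯`. -/
def fibonacciWord : ℕ → Fin 2 := limitWord fibonacci 0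

/-- The infinite word `φᵏ(x)`, where `φ` is the Thue–Morse morphism. -/
def thueMorseIterate (k : ℕ) (x : ℕ → Fin 2) : ℕ → Fin 2 := (image thueMorse)^[k] x

theorem mapWord_append {A B : Type*} (f : A → List B) (u v : List A) :
    mapWord f (u ++ v) = mapWord f u ++ mapWord f v := by simp [mapWord]

theorem iterate_mapWord_append {A : Type*} (f : A → List A) (n : ℕ) (u v : List A) :
    (mapWord f)^[n] (u ++ v) = (mapWord f)^[n] u ++ (mapWord f)^[n] v := by
  induction n generalizing u v with
  | zero => rfl
  | succ n ih => simp only [Function.iterate_succ_apply, mapWord_append, ih]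

theorem factorAt_add {A : Type*} (x : ℕ → A) (i m n : ℕ) :
    factorAt x i (m + n) = factorAt x i m ++ factorAt x (i + m) n := by
  simp [factorAt, List.range_add, Function.comp_def, Nat.add_assoc]

theorem le_length_mapWord {A B : Type*} {f : A → List B} (hf : ∀ a, f a ≠ []) (u : List A) :
    u.length ≤ (mapWord f u).length := by
  induction u with
  | nil => simp
  | cons a u ih =>
    have := List.length_pos_iff.2 (hf a)
    simp only [mapWord, List.flatMap_cons, List.length_append, List.length_cons] at ih ⊢
    omega

/-- For a non-erasing `f`, the image of every prefix of `x` is a prefix of `image f x`. -/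
theorem prefix_image {A : Type*} {f : A → List A} (hf : ∀ a, f a ≠ []) (x : ℕ → A) (n : ℕ) :
    mapWord f (factorAt x 0 n) = factorAt (image f x) 0 (mapWord f (factorAt x 0 n)).length := by
  have key : ∀ m p i d, i < (mapWord f (factorAt x 0 m)).length → m ≤ p →
      (mapWord f (factorAt x 0 p)).getD i d = (mapWord f (factorAt x 0 m)).getD i d := by
    intro m p i d hi hmp
    obtain ⟨q, rfl⟩ := Nat.exists_eq_add_of_le hmp
    rw [factorAt_add, mapWord_append, List.getD_append _ _ _ _ hi]
  refine List.ext_getElem (by simp [factorAt]) fun i hi _ => ?_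
  have hi' : i < (mapWord f (factorAt x 0 (i + 1))).length :=
    lt_of_lt_of_le (by simp [factorAt]) (le_length_mapWord hf _)
  rw [← List.getD_eq_getElem _ (x 0) hi]
  have hR : ∀ h, (factorAt (image f x) 0 (mapWord f (factorAt x 0 n)).length)[i]'h =
      (mapWord f (factorAt x 0 (i + 1))).getD i (x 0) := by
    intro h
    conv_lhs => simp only [factorAt, List.getElem_map, List.getElem_range, Nat.zero_add]
    rfl
  rw [hR]
  rcases le_total n (i + 1) with h | h
  · exact (key n (i + 1) i _ hi h).symm
  · exact key (i + 1) n i _ hi' h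

theorem lt_length_iterate {A : Type*} {f : A → List A} {a : A} (h : Prolongable f a) (n : ℕ) :
    n < ((mapWord f)^[n] [a]).length := by
  obtain ⟨u, hu, hn⟩ := h
  induction n with
  | zero => simp
  | succ n ih =>
    have h1 : mapWord f [a] = [a] ++ u := by simp [mapWord, hu]
    rw [Function.iterate_succ_apply, h1, iterate_mapWord_append, List.length_append]
    have := List.length_pos_iff.2 (hn n)
    omega

/-- If `f` is prolongable on `a`, all the words `fⁿ a` are prefixes of `limitWord f a`. -/
theorem prefix_limitWord {A : Type*} {f : A → List A} {a : A} (h : Prolongable f a) (n : ℕ) :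
    (mapWord f)^[n] [a] = factorAt (limitWord f a) 0 ((mapWord f)^[n] [a]).length := by
  have step : ∀ m q, ∃ v, (mapWord f)^[m + q] [a] = (mapWord f)^[m] [a] ++ v := by
    intro m q
    obtain ⟨u, hu, -⟩ := h
    have h1 : mapWord f [a] = [a] ++ u := by simp [mapWord, hu]
    induction q with
    | zero => exact ⟨[], by simp⟩
    | succ q ih =>
      obtain ⟨v, hv⟩ := ih
      refine ⟨v ++ (mapWord f)^[m + q] u, ?_⟩
      rw [← Nat.add_assoc, Function.iterate_succ_apply, h1, iterate_mapWord_append, hv,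
        List.append_assoc]
  have key : ∀ m p i d, i < ((mapWord f)^[m] [a]).length → m ≤ p →
      ((mapWord f)^[p] [a]).getD i d = ((mapWord f)^[m] [a]).getD i d := by
    intro m p i d hi hmp
    obtain ⟨q, rfl⟩ := Nat.exists_eq_add_of_le hmp
    obtain ⟨v, hv⟩ := step m q
    rw [hv, List.getD_append _ _ _ _ hi]
  refine List.ext_getElem (by simp [factorAt]) fun i hi _ => ?_
  rw [← List.getD_eq_getElem _ a hi]
  simp only [factorAt, List.getElem_map, List.getElem_range, Nat.zero_add]
  rcases le_total n i with h' | h'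
  · exact (key n i i _ hi h').symm
  · exact key i n i _ (lt_length_iterate h i) h'

end BinomialWords

open BinomialWords

namespace BinomialWords

open Polynomial

theorem binom_nil_right {A : Type*} [DecidableEq A] (u : List A) : binom u [] = 1 := by
  induction u with
  | nil => simp [binom]
  | cons a u ih =>
    have h : List.count [] (List.map (List.cons a) u.sublists') = 0 :=
      List.count_eq_zero.2 (by simp)
    simp only [binom] at ih
    simp [binom, List.sublists'_cons, List.count_append, h, ih]

theorem binom_nil_cons {A : Type*} [DecidableEq A] (b : A) (w : List A) :
    binom [] (b :: w) = 0 := by simp [binom]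

theorem binom_cons_cons {A : Type*} [DecidableEq A] (a b : A) (u w : List A) :
    binom (a :: u) (b :: w) = (if a = b then binom u w else 0) + binom u (b :: w) := by
  have h : List.count (b :: w) (List.map (List.cons a) u.sublists') =
      if a = b then List.count w u.sublists' else 0 := by
    split_ifs with hab
    · subst hab
      exact List.count_map_of_injective _ _ (List.cons_injective) _
    · refine List.count_eq_zero.2 fun h => ?_
      obtain ⟨v, -, hv⟩ := List.mem_map.1 h
      exact hab (List.cons.inj hv).1
  simp only [binom, List.sublists'_cons, List.count_append, h]
  omega

/-- The sum of the values of `F` on the suffixes of a word that follow a letter `c`. -/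
def suffixSum (c : Fin 2) (F : List (Fin 2) → ℤ) : List (Fin 2) → ℤ
  | [] => 0
  | a :: u => (if a = c then F u else 0) + suffixSum c F u

/-- `suffixSum` as a linear operator on functions of words. -/
def suffixSumHom (c : Fin 2) : (List (Fin 2) → ℤ) →ₗ[ℤ] (List (Fin 2) → ℤ) where
  toFun := suffixSum c
  map_add' F G := by
    funext u
    induction u with
    | nil => rfl
    | cons a u ih =>
      simp only [suffixSum, Pi.add_apply] at ih ⊢
      rw [ih]; split_ifs <;> ring
  map_smul' r F := by
    funext u
    induction u with
    | nil => simp [suffixSum]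
    | cons a u ih =>
      simp only [suffixSum, Pi.smul_apply, RingHom.id_apply, smul_eq_mul] at ih ⊢
      rw [ih]; split_ifs <;> ring

/-- The function `u ↦ binom u w`. -/
def binomFun (w u : List (Fin 2)) : ℤ := binom u w

/-- The function `u ↦ (|u| choose e)`. -/
def chooseLength (e : ℕ) (u : List (Fin 2)) : ℤ := u.length.choose e

/-- The span of the binomial coefficients of words of length at most `m`. -/
def binomSpan (m : ℕ) : Submodule ℤ (List (Fin 2) → ℤ) :=
  Submodule.span ℤ (binomFun '' {y | y.length ≤ m})

theorem binomFun_mem {y : List (Fin 2)} {m : ℕ} (h : y.length ≤ m) : binomFun y ∈ binomSpan m :=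
  Submodule.subset_span ⟨y, h, rfl⟩

theorem binomSpan_mono {m n : ℕ} (h : m ≤ n) : binomSpan m ≤ binomSpan n :=
  Submodule.span_mono (Set.image_mono fun _ hy => le_trans hy h)

theorem suffixSumHom_binomFun (c : Fin 2) (y : List (Fin 2)) :
    suffixSumHom c (binomFun y) = binomFun (c :: y) := by
  funext u
  change suffixSum c (binomFun y) u = _
  induction u with
  | nil => simp [suffixSum, binomFun, binom_nil_cons]
  | cons a u ih =>
    simp only [suffixSum, ih, binomFun, binom_cons_cons]
    push_cast
    rfl

theorem suffixSumHom_mem (c : Fin 2) {m : ℕ} {F : List (Fin 2) → ℤ} (hF : F ∈ binomSpan m) :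
    suffixSumHom c F ∈ binomSpan (m + 1) := by
  have : binomSpan m ≤ (binomSpan (m + 1)).comap (suffixSumHom c) := by
    refine Submodule.span_le.2 ?_
    rintro _ ⟨y, hy, rfl⟩
    change suffixSumHom c (binomFun y) ∈ binomSpan (m + 1)
    rw [suffixSumHom_binomFun]
    exact binomFun_mem (by simpa using hy)
  exact this hF

theorem chooseLength_succ (e : ℕ) :
    chooseLength (e + 1) =
      suffixSumHom 0 (chooseLength e) + suffixSumHom 1 (chooseLength e) := by
  funext u
  change _ = suffixSum 0 (chooseLength e) u + suffixSum 1 (chooseLength e) u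
  induction u with
  | nil => simp [suffixSum, chooseLength]
  | cons a u ih =>
    simp only [chooseLength, suffixSum, List.length_cons, Nat.choose_succ_succ] at ih ⊢
    push_cast
    rw [ih]
    fin_cases a <;> simp <;> ring

theorem chooseLength_zero : chooseLength 0 = binomFun [] := by
  funext u
  simp [chooseLength, binomFun, binom_nil_right]

theorem chooseLength_mem (e : ℕ) : chooseLength e ∈ binomSpan e := by
  induction e with
  | zero => exact chooseLength_zero ▸ binomFun_mem le_rfl
  | succ e ih =>
    rw [chooseLength_succ]
    exact add_mem (suffixSumHom_mem _ ih) (suffixSumHom_mem _ ih)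

theorem eq_of_mem_binomSpan {m : ℕ} {F : List (Fin 2) → ℤ} (hF : F ∈ binomSpan m)
    {u v : List (Fin 2)} (h : binomialSetoid (Fin 2) m u v) : F u = F v := by
  induction hF using Submodule.span_induction with
  | mem F hF =>
    obtain ⟨y, hy, rfl⟩ := hF
    exact congrArg Nat.cast (h y hy)
  | zero => rfl
  | add F G _ _ hF hG => simp [hF, hG]
  | smul r F _ hF => simp [hF]

theorem length_eq_of_binomial {m : ℕ} (hm : 1 ≤ m) {u v : List (Fin 2)}
    (h : binomialSetoid (Fin 2) m u v) : u.length = v.length := by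
  have := eq_of_mem_binomSpan (binomSpan_mono hm (chooseLength_mem 1)) h
  simpa [chooseLength] using this

/-- The Thue–Morse image of a letter is the letter followed by its complement. -/
theorem thueMorse_apply (a : Fin 2) : thueMorse a = [a, 1 - a] := by
  fin_cases a <;> rfl

theorem mapWord_thueMorse_cons (a : Fin 2) (u : List (Fin 2)) :
    mapWord thueMorse (a :: u) = a :: (1 - a) :: mapWord thueMorse u := by
  simp [mapWord, thueMorse_apply]

theorem length_mapWord_thueMorse (u : List (Fin 2)) :
    (mapWord thueMorse u).length = 2 * u.length := by
  induction u with
  | nil => rfl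
  | cons a u ih => simp [mapWord_thueMorse_cons, ih]; ring

/-- The function `u ↦ binom (φ u) w`. -/
def binomImage (w u : List (Fin 2)) : ℤ := binom (mapWord thueMorse u) w

theorem binomImage_nil : binomImage [] = chooseLength 0 := by
  funext u
  simp [chooseLength, binomImage, binom_nil_right]

theorem binomImage_singleton (b : Fin 2) :
    binomImage [b] = suffixSumHom 0 (binomImage []) + suffixSumHom 1 (binomImage []) := by
  funext u
  change _ = suffixSum 0 _ u + suffixSum 1 _ u
  induction u with
  | nil => simp [binomImage, suffixSum, mapWord, binom_nil_cons]
  | cons a u ih =>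
    simp only [binomImage, mapWord_thueMorse_cons, binom_cons_cons, suffixSum,
      binom_nil_right] at ih ⊢
    push_cast
    rw [ih]
    fin_cases a <;> fin_cases b <;> simp <;> ring

theorem binomImage_cons_cons (b c : Fin 2) (w : List (Fin 2)) :
    binomImage (b :: c :: w) =
      suffixSumHom 0 (binomImage (c :: w)) + suffixSumHom 1 (binomImage (c :: w)) +
        if b = c then 0 else suffixSumHom b (binomImage w) := by
  funext u
  have h : (if b = c then (0 : List (Fin 2) → ℤ) else suffixSumHom b (binomImage w)) u =
    if b = c then 0 else suffixSum b (binomImage w) u := by split_ifs <;> rfl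
  rw [Pi.add_apply, h]
  change _ = suffixSum 0 _ u + suffixSum 1 _ u + _
  induction u with
  | nil => simp [binomImage, suffixSum, mapWord, binom_nil_cons]
  | cons a u ih =>
    have ih := ih (by split_ifs <;> rfl)
    simp only [binomImage, mapWord_thueMorse_cons, binom_cons_cons, suffixSum] at ih ⊢
    push_cast
    rw [ih]
    fin_cases a <;> fin_cases b <;> fin_cases c <;> simp <;> ring

theorem binomImage_sub_mem (w : List (Fin 2)) :
    binomImage w - chooseLength w.length ∈ binomSpan (w.length - 1) := by
  have step : ∀ w : List (Fin 2), binomImage w - chooseLength w.length ∈ binomSpan (w.length - 1) →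
      binomImage w ∈ binomSpan w.length := fun w h => by
    have := add_mem (binomSpan_mono (Nat.sub_le _ _) h) (chooseLength_mem w.length)
    simpa using this
  match w with
  | [] => simp [binomImage_nil]
  | [b] => simp [binomImage_singleton, binomImage_nil, chooseLength_succ]
  | b :: c :: w =>
    have h₁ := binomImage_sub_mem (c :: w)
    have h₂ := step w (binomImage_sub_mem w)
    have h₃ : (if b = c then 0 else suffixSumHom b (binomImage w)) ∈
        binomSpan (w.length + 1) := by
      split_ifs
      · exact zero_mem _
      · exact suffixSumHom_mem _ h₂
    have h₄ := add_mem (add_mem (suffixSumHom_mem 0 h₁) (suffixSumHom_mem 1 h₁)) h₃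
    simp only [List.length_cons, Nat.add_sub_cancel, map_sub] at h₄ ⊢
    rw [chooseLength_succ, binomImage_cons_cons]
    convert h₄ using 1
    abel

/-- The Thue–Morse morphism maps `m`-binomially equivalent words of the same length to
`(m + 1)`-binomially equivalent words. -/
theorem binomial_mapWord_thueMorse {m : ℕ} {u v : List (Fin 2)} (hl : u.length = v.length)
    (h : binomialSetoid (Fin 2) m u v) :
    binomialSetoid (Fin 2) (m + 1) (mapWord thueMorse u) (mapWord thueMorse v) := by
  intro w hw
  have := eq_of_mem_binomSpan (binomSpan_mono (by omega) (binomImage_sub_mem w)) h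
  simp only [Pi.sub_apply, chooseLength, hl, binomImage] at this
  exact_mod_cast sub_left_injective this

/-- The sign of a letter. -/
def letterSign (a : Fin 2) : ℤ := 2 * (a : ℕ) - 1

/-- The polynomial `∑ ± Xᵖ`, the sum running over the letters of the word, with `p` the number of
letters that follow. -/
noncomputable def signPoly : List (Fin 2) → ℤ[X]
  | [] => 0
  | a :: u => C (letterSign a) * X ^ u.length + signPoly u

theorem signPoly_append (u v : List (Fin 2)) :
    signPoly (u ++ v) = X ^ v.length * signPoly u + signPoly v := by
  induction u with
  | nil => simp [signPoly]
  | cons a u ih => simp only [List.cons_append, signPoly, ih, List.length_append]; ring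

theorem signPoly_mapWord (u : List (Fin 2)) :
    signPoly (mapWord thueMorse u) = (X - C 1) * (signPoly u).comp (X ^ 2) := by
  induction u with
  | nil => simp [signPoly, mapWord]
  | cons a u ih =>
    have h : letterSign (1 - a) = - letterSign a := by fin_cases a <;> simp [letterSign]
    simp only [mapWord_thueMorse_cons, signPoly, ih, List.length_cons, length_mapWord_thueMorse,
      h, add_comp, mul_comp, C_comp, X_pow_comp, C_neg, C_1]
    ring

theorem coeff_signPoly_comp (e : ℕ) (u : List (Fin 2)) :
    ((signPoly u).comp (X + C 1)).coeff e =
      suffixSum 1 (chooseLength e) u - suffixSum 0 (chooseLength e) u := by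
  induction u with
  | nil => simp [signPoly, suffixSum]
  | cons a u ih =>
    simp only [signPoly, add_comp, mul_comp, C_comp, X_pow_comp, coeff_add, ih, coeff_C_mul,
      suffixSum]
    rw [C_1, coeff_X_add_one_pow]
    simp only [chooseLength]
    fin_cases a <;> simp [letterSign] <;> ring

/-- Words of the same length whose sign polynomials agree to order `m` at `1`. -/
def MomentEquiv (m : ℕ) (u v : List (Fin 2)) : Prop :=
  u.length = v.length ∧ (X - C 1) ^ m ∣ signPoly u - signPoly v

theorem MomentEquiv.of_binomial {m : ℕ} (hm : 1 ≤ m) {u v : List (Fin 2)}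
    (h : binomialSetoid (Fin 2) m u v) : MomentEquiv m u v := by
  refine ⟨length_eq_of_binomial hm h, ?_⟩
  rw [X_sub_C_pow_dvd_iff, X_pow_dvd_iff]
  intro e he
  rw [sub_comp, coeff_sub, coeff_signPoly_comp, coeff_signPoly_comp, sub_eq_zero]
  exact eq_of_mem_binomSpan (F := suffixSumHom 1 (chooseLength e) - suffixSumHom 0 (chooseLength e))
    (binomSpan_mono he (sub_mem (suffixSumHom_mem _ (chooseLength_mem e))
      (suffixSumHom_mem _ (chooseLength_mem e)))) h

theorem MomentEquiv.symm {m : ℕ} {u v : List (Fin 2)} (h : MomentEquiv m u v) :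
    MomentEquiv m v u := ⟨h.1.symm, by simpa using h.2.neg_right⟩

theorem MomentEquiv.mono {m n : ℕ} (hmn : m ≤ n) {u v : List (Fin 2)} (h : MomentEquiv n u v) :
    MomentEquiv m u v := ⟨h.1, (pow_dvd_pow _ hmn).trans h.2⟩

theorem dvd_of_dvd_comp_sq {m : ℕ} {p : ℤ[X]} (h : (X - C 1) ^ m ∣ p.comp (X ^ 2)) :
    (X - C 1) ^ m ∣ p := by
  induction m generalizing p with
  | zero => simp
  | succ m ih =>
    have h1 : X - C 1 ∣ p := by
      rw [dvd_iff_isRoot]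
      have := dvd_iff_isRoot.1 ((dvd_pow_self _ m.succ_ne_zero).trans h)
      simpa [IsRoot, eval_comp] using this
    obtain ⟨q, rfl⟩ := h1
    have h2 : ((X - C 1) * q).comp (X ^ 2) = (X - C 1) * ((X + C 1) * q.comp (X ^ 2)) := by
      simp only [mul_comp, sub_comp, X_comp, C_1, one_comp]; ring
    rw [h2, pow_succ', mul_dvd_mul_iff_left (X_sub_C_ne_zero 1)] at h
    rw [pow_succ', mul_dvd_mul_iff_left (X_sub_C_ne_zero 1)]
    refine ih ((prime_X_sub_C 1).pow_dvd_of_dvd_mul_left m ?_ h)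
    rw [dvd_iff_isRoot]
    simp [IsRoot]

theorem MomentEquiv.of_mapWord {m : ℕ} {u v : List (Fin 2)}
    (h : MomentEquiv (m + 1) (mapWord thueMorse u) (mapWord thueMorse v)) :
    MomentEquiv m u v := by
  refine ⟨by simpa [length_mapWord_thueMorse] using h.1, ?_⟩
  have := h.2
  rw [signPoly_mapWord, signPoly_mapWord, ← mul_sub, pow_succ',
    mul_dvd_mul_iff_left (X_sub_C_ne_zero 1), ← sub_comp] at this
  exact dvd_of_dvd_comp_sq this

theorem MomentEquiv.of_append_left {m : ℕ} {p u v : List (Fin 2)}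
    (h : MomentEquiv m (p ++ u) (p ++ v)) : MomentEquiv m u v := by
  have hl : u.length = v.length := by simpa using h.1
  refine ⟨hl, ?_⟩
  simpa [signPoly_append, hl] using h.2

theorem MomentEquiv.of_append_right {m : ℕ} {s u v : List (Fin 2)}
    (h : MomentEquiv m (u ++ s) (v ++ s)) : MomentEquiv m u v := by
  refine ⟨by simpa using h.1, ?_⟩
  have h2 := h.2
  simp only [signPoly_append, add_sub_add_right_eq_sub, ← mul_sub] at h2
  refine (prime_X_sub_C 1).pow_dvd_of_dvd_mul_left m ?_ h2
  rw [dvd_iff_isRoot]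
  simp [IsRoot]

/-- The number of letters `1` minus the number of letters `0`. -/
noncomputable def signSum (u : List (Fin 2)) : ℤ := (signPoly u).eval 1

/-- The sum of the signs of the letters, weighted with the number of letters that follow. -/
noncomputable def signMoment (u : List (Fin 2)) : ℤ := (derivative (signPoly u)).eval 1

theorem MomentEquiv.signSum_eq {u v : List (Fin 2)} (h : MomentEquiv 2 u v) :
    signSum u = signSum v := by
  obtain ⟨q, hq⟩ := h.2
  have := congrArg (eval 1) hq
  simp at this
  simp only [signSum]; linarith

theorem MomentEquiv.signMoment_eq {u v : List (Fin 2)} (h : MomentEquiv 2 u v) :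
    signMoment u = signMoment v := by
  obtain ⟨q, hq⟩ := h.2
  have := congrArg (fun p => eval 1 (derivative p)) hq
  simp [derivative_mul, derivative_pow] at this
  simp only [signMoment]; linarith

theorem signSum_append (u v : List (Fin 2)) : signSum (u ++ v) = signSum u + signSum v := by
  simp [signSum, signPoly_append]

theorem signMoment_append (u v : List (Fin 2)) :
    signMoment (u ++ v) = v.length * signSum u + signMoment u + signMoment v := by
  simp [signMoment, signSum, signPoly_append, derivative_X_pow]

theorem signSum_singleton (a : Fin 2) : signSum [a] = letterSign a := by
  simp [signSum, signPoly]

theorem signMoment_singleton (a : Fin 2) : signMoment [a] = 0 := by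
  simp [signMoment, signPoly]

theorem signSum_mapWord (u : List (Fin 2)) : signSum (mapWord thueMorse u) = 0 := by
  simp [signSum, signPoly_mapWord]

theorem signMoment_mapWord (u : List (Fin 2)) :
    signMoment (mapWord thueMorse u) = signSum u := by
  simp [signSum, signMoment, signPoly_mapWord, eval_comp]

theorem momentEquiv_one_iff {u v : List (Fin 2)} :
    MomentEquiv 1 u v ↔ u.length = v.length ∧ signSum u = signSum v := by
  rw [MomentEquiv, pow_one, dvd_iff_isRoot]
  simp [IsRoot, signSum, sub_eq_zero]


theorem length_factorAt {A : Type*} (x : ℕ → A) (i n : ℕ) : (factorAt x i n).length = n := by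
  simp [factorAt]

theorem factorAt_succ {A : Type*} (x : ℕ → A) (i n : ℕ) :
    factorAt x i (n + 1) = factorAt x i n ++ [x (i + n)] := by
  rw [factorAt_add]; simp [factorAt]

theorem factorAt_succ' {A : Type*} (x : ℕ → A) (i n : ℕ) :
    factorAt x i (n + 1) = x i :: factorAt x (i + 1) n := by
  rw [Nat.add_comm, factorAt_add]; simp [factorAt]

theorem factorAt_eq_iff {A : Type*} {x : ℕ → A} {i j n : ℕ} :
    factorAt x i n = factorAt x j n ↔ ∀ t < n, x (i + t) = x (j + t) := by
  simp [factorAt]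

theorem finite_factors {A : Type*} [Finite A] (x : ℕ → A) (n : ℕ) : (factors x n).Finite := by
  refine (List.finite_length_eq A n).subset ?_
  rintro _ ⟨i, rfl⟩
  exact length_factorAt x i n

theorem getElem?_mapWord_thueMorse (u : List (Fin 2)) (q : ℕ) :
    (mapWord thueMorse u)[2 * q]? = u[q]? ∧
      (mapWord thueMorse u)[2 * q + 1]? = u[q]?.map (1 - ·) := by
  induction u generalizing q with
  | nil => simp [mapWord]
  | cons a u ih =>
    rw [mapWord_thueMorse_cons]
    cases q with
    | zero => simp
    | succ q => simpa [Nat.mul_succ] using ih q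

theorem image_thueMorse_even (x : ℕ → Fin 2) (q : ℕ) : image thueMorse x (2 * q) = x q := by
  have h : q < 2 * q + 1 := by omega
  rw [image, List.getD_eq_getElem?_getD, (getElem?_mapWord_thueMorse _ q).1]
  simp [factorAt, h]

theorem image_thueMorse_odd (x : ℕ → Fin 2) (q : ℕ) :
    image thueMorse x (2 * q + 1) = 1 - x q := by
  have h : q < 2 * q + 1 + 1 := by omega
  rw [image, List.getD_eq_getElem?_getD, (getElem?_mapWord_thueMorse _ q).2]
  simp [factorAt, h]

theorem factorAt_image_even (x : ℕ → Fin 2) (q N : ℕ) :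
    factorAt (image thueMorse x) (2 * q) (2 * N) = mapWord thueMorse (factorAt x q N) := by
  induction N generalizing q with
  | zero => rfl
  | succ N ih =>
    rw [Nat.mul_succ, factorAt_succ', factorAt_succ', factorAt_succ', mapWord_thueMorse_cons,
      image_thueMorse_even, image_thueMorse_odd]
    exact congrArg _ (congrArg _ (ih (q + 1)))

/-- The factors of length `n` of `x` are determined by their class for the relation
`MomentEquiv m`. -/
def Separated (m : ℕ) (x : ℕ → Fin 2) : Prop :=
  ∀ n i j, MomentEquiv m (factorAt x i n) (factorAt x j n) → factorAt x i n = factorAt x j n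

theorem letterSign_cases (a : Fin 2) : letterSign a = 1 ∧ a = 1 ∨ letterSign a = -1 ∧ a = 0 := by
  fin_cases a <;> simp [letterSign]

theorem signSum_nil : signSum [] = 0 := by simp [signSum, signPoly]

theorem signMoment_nil : signMoment [] = 0 := by simp [signMoment, signPoly]

theorem signSum_cons (a : Fin 2) (u : List (Fin 2)) : signSum (a :: u) = letterSign a + signSum u := by
  rw [← signSum_singleton, ← signSum_append]; rfl

theorem signMoment_cons (a : Fin 2) (u : List (Fin 2)) :
    signMoment (a :: u) = u.length * letterSign a + signMoment u := by
  rw [← signSum_singleton, ← add_zero (_ * _), ← signMoment_singleton a, ← signMoment_append]; rfl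

theorem abs_signSum_le (u : List (Fin 2)) : |signSum u| ≤ u.length := by
  induction u with
  | nil => simp [signSum, signPoly]
  | cons a u ih =>
    rw [signSum_cons, List.length_cons]
    rw [abs_le] at ih ⊢
    push_cast
    rcases letterSign_cases a with h | h <;> constructor <;> linarith

theorem eq_replicate_of_signSum {u : List (Fin 2)} {b : Fin 2}
    (h : signSum u = letterSign b * u.length) : u = List.replicate u.length b := by
  induction u with
  | nil => rfl
  | cons a u ih =>
    have h1 := abs_le.1 (abs_signSum_le u)
    rw [signSum_cons, List.length_cons] at h
    push_cast at h
    rw [List.length_cons, List.replicate_succ]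
    have : a = b ∧ signSum u = letterSign b * u.length := by
      rcases letterSign_cases a with ⟨ha, ha'⟩ | ⟨ha, ha'⟩ <;>
      rcases letterSign_cases b with ⟨hb, hb'⟩ | ⟨hb, hb'⟩ <;> rw [ha, hb] at h
      · exact ⟨ha'.trans hb'.symm, by rw [hb]; linarith⟩
      · linarith
      · linarith
      · exact ⟨ha'.trans hb'.symm, by rw [hb]; linarith⟩
    rw [← ih this.2, this.1]

theorem mapWord_replicate_append (b : Fin 2) (N : ℕ) :
    mapWord thueMorse (List.replicate N b) ++ [b] =
      b :: mapWord thueMorse (List.replicate N (1 - b)) := by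
  induction N with
  | zero => rfl
  | succ N ih =>
    rw [List.replicate_succ, List.replicate_succ, mapWord_thueMorse_cons, mapWord_thueMorse_cons,
      List.cons_append, List.cons_append, ih, sub_sub_cancel]

theorem letterSign_one_sub (a : Fin 2) : letterSign (1 - a) = -letterSign a := by
  fin_cases a <;> simp [letterSign]

theorem letterSign_injective : Function.Injective letterSign := by
  intro a b h
  fin_cases a <;> fin_cases b <;> simp_all [letterSign]

theorem eq_of_shifted_odd {u v : List (Fin 2)} {b c : Fin 2}
    (h : MomentEquiv 2 (mapWord thueMorse u ++ [c]) (b :: mapWord thueMorse v)) :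
    mapWord thueMorse u ++ [c] = b :: mapWord thueMorse v := by
  have hl : u.length = v.length := by
    have := h.1
    simp [length_mapWord_thueMorse] at this
    exact this
  have h1 := h.signSum_eq
  have h2 := h.signMoment_eq
  simp only [signSum_cons, signMoment_cons, signSum_append, signMoment_append, signSum_mapWord,
    signMoment_mapWord, signSum_nil, signMoment_nil, length_mapWord_thueMorse, List.length_singleton, List.length_nil] at h1 h2
  have hu := abs_le.1 (abs_signSum_le u)
  have hv := abs_le.1 (abs_signSum_le v)
  obtain rfl : c = b := letterSign_injective (by linarith)
  rw [hl] at hu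
  push_cast at h2
  have hu' : signSum u = letterSign c * u.length := by
    rw [hl]
    rcases letterSign_cases c with h | h <;> rw [h.1] at h2 ⊢ <;> linarith
  have hv' : signSum v = letterSign (1 - c) * v.length := by
    rw [letterSign_one_sub]
    rcases letterSign_cases c with h | h <;> rw [h.1] at h2 ⊢ <;> linarith
  rw [eq_replicate_of_signSum hu', eq_replicate_of_signSum hv', hl, mapWord_replicate_append]

theorem eq_of_shifted_even {u v : List (Fin 2)} {b c : Fin 2}
    (h : MomentEquiv 2 (mapWord thueMorse u) (b :: (mapWord thueMorse v ++ [c]))) :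
    mapWord thueMorse u = b :: (mapWord thueMorse v ++ [c]) := by
  have hl : u.length = v.length + 1 := by
    have := h.1
    simp [length_mapWord_thueMorse] at this
    omega
  have h1 := h.signSum_eq
  have h2 := h.signMoment_eq
  simp only [signSum_cons, signMoment_cons, signSum_append, signMoment_append, signSum_mapWord,
    signMoment_mapWord, signSum_nil, signMoment_nil, length_mapWord_thueMorse, List.length_append,
    List.length_singleton, List.length_nil] at h1 h2
  have hu := abs_le.1 (abs_signSum_le u)
  have hv := abs_le.1 (abs_signSum_le v)
  obtain rfl : c = 1 - b := letterSign_injective (by rw [letterSign_one_sub]; linarith)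
  rw [hl] at hu
  push_cast at h2 hu
  have hu' : signSum u = letterSign b * u.length := by
    rw [hl]; push_cast
    rcases letterSign_cases b with h | h <;> rw [h.1] at h2 ⊢ <;> linarith
  have hv' : signSum v = letterSign (1 - b) * v.length := by
    rw [letterSign_one_sub]
    rcases letterSign_cases b with h | h <;> rw [h.1] at h2 ⊢ <;> linarith
  rw [eq_replicate_of_signSum hu', eq_replicate_of_signSum hv', hl, mapWord_replicate_append,
    sub_sub_cancel, List.replicate_succ, mapWord_thueMorse_cons]

theorem Separated.image {m : ℕ} (hm : 1 ≤ m) {x : ℕ → Fin 2} (hx : Separated m x) :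
    Separated (m + 1) (image thueMorse x) := by
  have key : ∀ N p q, MomentEquiv (m + 1) (mapWord thueMorse (factorAt x p N))
      (mapWord thueMorse (factorAt x q N)) → factorAt x p N = factorAt x q N :=
    fun N p q h => hx N p q h.of_mapWord
  intro n i j h
  have h2 : MomentEquiv 2 _ _ := h.mono (by omega)
  rcases Nat.even_or_odd' i with ⟨p, rfl | rfl⟩ <;> rcases Nat.even_or_odd' j with ⟨q, rfl | rfl⟩ <;>
  rcases Nat.even_or_odd' n with ⟨N, rfl | rfl⟩
  · rw [factorAt_image_even, factorAt_image_even] at h ⊢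
    rw [key N p q h]
  · rw [factorAt_succ, factorAt_succ, factorAt_image_even, factorAt_image_even] at h h2 ⊢
    have h1 := h2.signSum_eq
    simp only [signSum_append, signSum_mapWord, signSum_singleton] at h1
    rw [letterSign_injective (add_left_cancel h1)] at h ⊢
    rw [key N p q h.of_append_right]
  · rcases N with _ | N
    · rfl
    have e : 2 * (N + 1) = 2 * N + 1 + 1 := by ring
    have e' : 2 * q + 1 + 1 = 2 * (q + 1) := by ring
    rw [factorAt_image_even] at h2 ⊢
    rw [e, factorAt_succ' (BinomialWords.image _ _), factorAt_succ (BinomialWords.image _ _),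
      e', factorAt_image_even] at h2 ⊢
    exact eq_of_shifted_even h2
  · have e' : 2 * q + 1 + 1 = 2 * (q + 1) := by ring
    rw [factorAt_succ, factorAt_succ', e', factorAt_image_even, factorAt_image_even] at h2 ⊢
    exact eq_of_shifted_odd h2
  · rcases N with _ | N
    · rfl
    have e : 2 * (N + 1) = 2 * N + 1 + 1 := by ring
    have e' : 2 * p + 1 + 1 = 2 * (p + 1) := by ring
    rw [factorAt_image_even _ q] at h2 ⊢
    rw [e, factorAt_succ' (BinomialWords.image _ _), factorAt_succ (BinomialWords.image _ _),
      e', factorAt_image_even] at h2 ⊢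
    exact (eq_of_shifted_even h2.symm).symm
  · have e' : 2 * p + 1 + 1 = 2 * (p + 1) := by ring
    rw [factorAt_succ', factorAt_succ, e', factorAt_image_even, factorAt_image_even] at h2 ⊢
    exact (eq_of_shifted_odd h2.symm).symm
  · rcases N with _ | N
    · rfl
    have e : 2 * (N + 1) = 2 * N + 1 + 1 := by ring
    have ep : 2 * p + 1 + 1 = 2 * (p + 1) := by ring
    have eq : 2 * q + 1 + 1 = 2 * (q + 1) := by ring
    rw [e, factorAt_succ', factorAt_succ' _ (2 * q + 1), factorAt_succ, factorAt_succ _ (2 * q + 1 + 1),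
      ep, eq, factorAt_image_even, factorAt_image_even] at h h2 ⊢
    set b := BinomialWords.image thueMorse x (2 * p + 1)
    set b' := BinomialWords.image thueMorse x (2 * q + 1)
    set c := BinomialWords.image thueMorse x (2 * (p + 1) + 2 * N)
    set c' := BinomialWords.image thueMorse x (2 * (q + 1) + 2 * N)
    have h1 := h2.signSum_eq
    have h3 := h2.signMoment_eq
    simp only [signSum_cons, signMoment_cons, signSum_append, signMoment_append, signSum_mapWord, signMoment_mapWord,
      signSum_nil, signMoment_nil, length_mapWord_thueMorse, List.length_append,
      List.length_singleton, List.length_nil, length_factorAt] at h1 h3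
    have hu := abs_le.1 (abs_signSum_le (factorAt x (p + 1) N))
    have hv := abs_le.1 (abs_signSum_le (factorAt x (q + 1) N))
    rw [length_factorAt] at hu hv
    push_cast at h3
    have hb : letterSign b = letterSign b' := by
      rcases letterSign_cases b with h | h <;> rcases letterSign_cases b' with h' | h' <;>
        rw [h.1, h'.1] at h3 ⊢ <;> linarith
    have hc : c = c' := letterSign_injective (by linarith)
    rw [letterSign_injective hb, hc] at h ⊢
    rw [← List.singleton_append, ← List.singleton_append (x := b')] at h
    rw [key N _ _ h.of_append_left.of_append_right]
  · have ep : 2 * p + 1 + 1 = 2 * (p + 1) := by ring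
    have eq : 2 * q + 1 + 1 = 2 * (q + 1) := by ring
    rw [factorAt_succ', factorAt_succ', ep, eq, factorAt_image_even, factorAt_image_even]
      at h h2 ⊢
    have h1 := h2.signSum_eq
    simp only [signSum_cons, signSum_mapWord] at h1
    rw [letterSign_injective (add_right_cancel h1)] at h ⊢
    rw [← List.singleton_append, ← List.singleton_append (l := mapWord _ (factorAt x (q + 1) N))]
      at h
    rw [key N _ _ h.of_append_left]

/-- For infinitely many `n`, two factors of length `n` are `m`-binomially equivalent but differ
for `MomentEquiv (m + 1)`. -/
def SplitsAt (m : ℕ) (x : ℕ → Fin 2) : Prop :=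
  ∀ N, ∃ n ≥ N, ∃ i j, binomialSetoid (Fin 2) m (factorAt x i n) (factorAt x j n) ∧
    ¬ MomentEquiv (m + 1) (factorAt x i n) (factorAt x j n)

theorem SplitsAt.image {m : ℕ} {x : ℕ → Fin 2} (hx : SplitsAt m x) :
    SplitsAt (m + 1) (image thueMorse x) := by
  intro N
  obtain ⟨n, hn, i, j, h1, h2⟩ := hx N
  refine ⟨2 * n, by omega, 2 * i, 2 * j, ?_, ?_⟩ <;>
    rw [factorAt_image_even, factorAt_image_even]
  · exact binomial_mapWord_thueMorse (by simp [length_factorAt]) h1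
  · exact fun h => h2 h.of_mapWord

/-- The infinite word `x` is not purely periodic. -/
def Nonperiodic {A : Type*} (x : ℕ → A) : Prop := ∀ n, 1 ≤ n → ∃ i, x (i + n) ≠ x i

theorem Nonperiodic.image {x : ℕ → Fin 2} (hx : Nonperiodic x) :
    Nonperiodic (image thueMorse x) := by
  intro n hn
  obtain ⟨i, hi⟩ := hx n hn
  by_contra! h
  refine hi ?_
  rw [← image_thueMorse_even x, ← image_thueMorse_even x, ← h (2 * i), ← h (2 * i + n)]
  congr 1; ring

theorem Nonperiodic.splitsAt_zero {x : ℕ → Fin 2} (hx : Nonperiodic x) : SplitsAt 0 x := by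
  intro N
  obtain ⟨i, hi⟩ := hx (N + 1) (by omega)
  refine ⟨N + 1, by omega, i, i + 1, fun w hw => ?_, fun h => hi ?_⟩
  · rw [List.length_eq_zero_iff.1 (Nat.le_zero.1 hw), binom_nil_right, binom_nil_right]
  · have := (momentEquiv_one_iff.1 h).2
    rw [factorAt_succ', factorAt_succ, signSum_cons, signSum_append, signSum_singleton] at this
    rw [letterSign_injective (by linarith : letterSign (x i) = _), Nat.add_comm N, Nat.add_assoc]

theorem SplitsAt.infinitelyOftenLT {m : ℕ} {x : ℕ → Fin 2} (hx : SplitsAt m x) :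
    binomialComplexity m x ≺ binomialComplexity (m + 1) x := by
  refine Set.infinite_of_not_bddAbove fun ⟨N, hN⟩ => ?_
  obtain ⟨n, hn, i, j, h1, h2⟩ := hx (N + 1)
  refine absurd (hN (a := n) ?_) (by omega)
  let g : Quotient (binomialSetoid (Fin 2) (m + 1)) → Quotient (binomialSetoid (Fin 2) m) :=
    Quotient.map id fun _ _ h w hw => h w (hw.trans (Nat.le_succ m))
  set S := (fun u => (Quotient.mk (binomialSetoid (Fin 2) (m + 1)) u)) '' factors x n with hS
  have hfin : S.Finite := (finite_factors x n).image _
  have hg : (fun u => (Quotient.mk (binomialSetoid (Fin 2) m) u)) '' factors x n = g '' S := by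
    rw [hS, Set.image_image]; rfl
  change Set.ncard _ < Set.ncard S
  rw [hg]
  refine lt_of_le_of_ne (Set.ncard_image_le hfin) fun h => ?_
  have hinj := (Set.ncard_image_iff hfin).1 h
  have := hinj (Set.mem_image_of_mem _ ⟨i, rfl⟩) (Set.mem_image_of_mem _ ⟨j, rfl⟩)
    (Quotient.sound (s := binomialSetoid (Fin 2) m) h1)
  exact h2 (MomentEquiv.of_binomial (by omega) (Quotient.exact this))

theorem Separated.binomialComplexity_eq {m : ℕ} (hm : 1 ≤ m) {x : ℕ → Fin 2}
    (hx : Separated m x) : binomialComplexity m x = factorComplexity x := by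
  funext n
  refine Set.InjOn.ncard_image ?_
  rintro _ ⟨i, rfl⟩ _ ⟨j, rfl⟩ h
  exact hx n i j (MomentEquiv.of_binomial hm (Quotient.exact h))

theorem complexityChain_thueMorseIterate {s : ℕ → Fin 2} (h0 : Nonperiodic s)
    (h1 : SplitsAt 1 s) (h2 : Separated 2 s) (k : ℕ) :
    ComplexityChain (k + 2) (thueMorseIterate k s) := by
  have key : Nonperiodic (thueMorseIterate k s) ∧ Separated (k + 2) (thueMorseIterate k s) ∧
      ∀ j, j < k + 2 → SplitsAt j (thueMorseIterate k s) := by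
    induction k with
    | zero =>
      refine ⟨h0, h2, fun j hj => ?_⟩
      interval_cases j
      · exact h0.splitsAt_zero
      · exact h1
    | succ k ih =>
      obtain ⟨hn, hs, hj⟩ := ih
      rw [thueMorseIterate, Function.iterate_succ_apply']
      refine ⟨hn.image, hs.image (by omega), fun j hjk => ?_⟩
      rcases j with _ | j
      · exact hn.image.splitsAt_zero
      · exact (hj j (by omega)).image
  exact ⟨fun j _ hj => (key.2.2 j hj).infinitelyOftenLT,
    key.2.1.binomialComplexity_eq (by omega)⟩


/-- The factors of length `n` of `x` at `i` and `j` agree. -/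
def Agree {A : Type*} (x : ℕ → A) (i j n : ℕ) : Prop := ∀ t < n, x (i + t) = x (j + t)

theorem Agree.succ {A : Type*} {x : ℕ → A} {i j n : ℕ} (h : Agree x i j n)
    (h' : x (i + n) = x (j + n)) : Agree x i j (n + 1) := by
  intro t ht
  rcases Nat.lt_succ_iff_lt_or_eq.1 ht with ht | rfl
  exacts [h t ht, h']

theorem Agree.tail {A : Type*} {x : ℕ → A} {i j n : ℕ} (h : Agree x i j (n + 1)) :
    Agree x (i + 1) (j + 1) n := by
  intro t ht
  have := h (t + 1) (by omega)
  rwa [← Nat.add_assoc, Nat.add_right_comm, ← Nat.add_assoc, Nat.add_right_comm j] at this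

theorem Agree.cons {A : Type*} {x : ℕ → A} {i j n : ℕ} (h : Agree x (i + 1) (j + 1) n)
    (h' : x i = x j) : Agree x i j (n + 1) := by
  intro t ht
  rcases t with _ | t
  · exact h'
  · have := h t (by omega)
    rwa [Nat.add_right_comm, Nat.add_assoc, Nat.add_right_comm j, Nat.add_assoc] at this

theorem Agree.symm {A : Type*} {x : ℕ → A} {i j n : ℕ} (h : Agree x i j n) : Agree x j i n :=
  fun t ht => (h t ht).symm

theorem Agree.trans {A : Type*} {x : ℕ → A} {i j k n : ℕ} (h : Agree x i j n)
    (h' : Agree x j k n) : Agree x i k n :=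
  fun t ht => (h t ht).trans (h' t ht)

theorem Agree.mono {A : Type*} {x : ℕ → A} {i j m n : ℕ} (h : Agree x i j n) (hm : m ≤ n) :
    Agree x i j m := fun t ht => h t (ht.trans_le hm)

/-- The factor of length `n` of `x` at `i` is right special. -/
def RightSpecial {A : Type*} (x : ℕ → A) (i n : ℕ) : Prop :=
  ∃ j, Agree x i j n ∧ x (i + n) ≠ x (j + n)

theorem RightSpecial.congr {A : Type*} {x : ℕ → A} {i j n : ℕ} (hi : RightSpecial x i n)
    (h : Agree x i j n) : RightSpecial x j n := by
  obtain ⟨k, hk, hne⟩ := hi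
  by_cases hj : x (i + n) = x (j + n)
  · exact ⟨k, h.symm.trans hk, hj ▸ hne⟩
  · exact ⟨i, h.symm, Ne.symm hj⟩

theorem RightSpecial.tail {A : Type*} {x : ℕ → A} {i n : ℕ} (hi : RightSpecial x i (n + 1)) :
    RightSpecial x (i + 1) n := by
  obtain ⟨k, hk, hne⟩ := hi
  refine ⟨k + 1, hk.tail, ?_⟩
  rwa [Nat.add_right_comm, Nat.add_right_comm k]

/-- A Sturmian word is not eventually periodic. -/
theorem IsSturmian.not_eventually_periodic {s : ℕ → Fin 2} (hs : IsSturmian s) {n : ℕ}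
    (hn : 1 ≤ n) (N : ℕ) : ∃ i ≥ N, s (i + n) ≠ s i := by
  by_contra! h
  have key : ∀ i, ∃ j < N + n, ∀ m, Agree s i j m := by
    intro i
    induction i using Nat.strong_induction_on with
    | _ i ih =>
      by_cases hi : i < N + n
      · exact ⟨i, hi, fun _ _ _ => rfl⟩
      · obtain ⟨j, hj, hm⟩ := ih (i - n) (by omega)
        refine ⟨j, hj, fun m => Agree.trans (fun t _ => ?_) (hm m)⟩
        rw [← h (i - n + t) (by omega)]
        congr 1; omega
  have hsub : factors s (N + n) ⊆
      (fun j => factorAt s j (N + n)) '' (Finset.range (N + n) : Set ℕ) := by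
    rintro _ ⟨i, rfl⟩
    obtain ⟨j, hj, hm⟩ := key i
    exact ⟨j, by simpa using hj, (factorAt_eq_iff.2 (hm _)).symm⟩
  have h1 := Set.ncard_le_ncard hsub ((Finset.finite_toSet _).image _)
  have h2 := Set.ncard_image_le (f := fun j => factorAt s j (N + n))
    (Finset.finite_toSet (Finset.range (N + n)))
  rw [Set.ncard_coe_finset, Finset.card_range] at h2
  have h3 : (factors s (N + n)).ncard = N + n + 1 := hs (N + n)
  omega

theorem IsSturmian.nonperiodic {s : ℕ → Fin 2} (hs : IsSturmian s) : Nonperiodic s :=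
  fun _ hn => let ⟨i, _, h⟩ := hs.not_eventually_periodic hn 0; ⟨i, h⟩

/-- A Sturmian word has at most one right special factor of each length. -/
theorem IsSturmian.rightSpecial_unique {s : ℕ → Fin 2} (hs : IsSturmian s) {i j n : ℕ}
    (hi : RightSpecial s i n) (hj : RightSpecial s j n) : Agree s i j n := by
  by_contra hne
  obtain ⟨i', hi, hi'⟩ := hi
  obtain ⟨j', hj, hj'⟩ := hj
  have drop : ∀ i, (factorAt s i (n + 1)).dropLast = factorAt s i n := fun i => by
    rw [factorAt_succ, List.dropLast_concat]
  have hfin := finite_factors s (n + 1)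
  set T : Set (List (Fin 2)) := {factorAt s i (n + 1), factorAt s j (n + 1)} with hT
  have hT2 : T.ncard = 2 := Set.ncard_pair fun h => hne fun t ht => factorAt_eq_iff.1 h t (by omega)
  have hTs : T ⊆ factors s (n + 1) := by
    rintro _ (rfl | rfl)
    exacts [⟨i, rfl⟩, ⟨j, rfl⟩]
  have mem : ∀ k, factorAt s k (n + 1) ∉ T →
      factorAt s k n ∈ List.dropLast '' (factors s (n + 1) \ T) :=
    fun k hk => ⟨_, ⟨⟨k, rfl⟩, hk⟩, drop k⟩
  have hsub : factors s n ⊆ List.dropLast '' (factors s (n + 1) \ T) := by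
    rintro _ ⟨k, rfl⟩
    change factorAt s k n ∈ _
    by_cases hk : factorAt s k (n + 1) ∈ T
    · rcases hk with hk | hk
      · have : factorAt s k n = factorAt s i' n := by
          rw [← drop, hk, drop]; exact factorAt_eq_iff.2 hi
        rw [this]
        refine mem i' ?_
        rintro (h | h)
        · exact hi' (factorAt_eq_iff.1 h n (by omega)).symm
        · exact hne (hi.trans fun t ht => factorAt_eq_iff.1 h t (by omega))
      · have : factorAt s k n = factorAt s j' n := by
          rw [← drop, show factorAt s k (n + 1) = _ from hk, drop]; exact factorAt_eq_iff.2 hj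
        rw [this]
        refine mem j' ?_
        rintro (h | h)
        · exact hne (hj.trans fun t ht => factorAt_eq_iff.1 h t (by omega)).symm
        · exact hj' (factorAt_eq_iff.1 h n (by omega)).symm
    · exact mem k hk
  have h1 := Set.ncard_le_ncard hsub (hfin.sdiff.image _)
  have h2 := Set.ncard_image_le (f := List.dropLast) (hfin.sdiff (t := T))
  have h3 := Set.ncard_sdiff hTs (Set.toFinite T)
  have h4 : (factors s n).ncard = n + 1 := hs n
  have h5 : (factors s (n + 1)).ncard = n + 1 + 1 := hs (n + 1)
  omega

/-- If a stretch between two occurrences of a factor contains no right special factor, then the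
word is eventually periodic. -/
theorem eventually_periodic_of_not_rightSpecial {A : Type*} {x : ℕ → A} {i j m : ℕ} (hm : 1 ≤ m)
    (hij : i < j) (h : Agree x i j m) (hns : ∀ k, i ≤ k → k < j → ¬ RightSpecial x k m) (t : ℕ) :
    x (i + t) = x (j + t) := by
  have key : ∀ t, Agree x (i + t) (j + t) m ∧ ∃ k, i ≤ k ∧ k < j ∧ Agree x k (i + t) m := by
    intro t
    induction t with
    | zero => exact ⟨h, i, le_rfl, hij, fun _ _ => rfl⟩
    | succ t ih =>
      obtain ⟨h1, k, hik, hkj, h2⟩ := ih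
      have next : ∀ q, Agree x k q m → Agree x (k + 1) (q + 1) m := by
        intro q hq
        refine (hq.succ ?_).tail
        by_contra hne
        exact hns k hik hkj ⟨q, hq, hne⟩
      have h3 := next _ h2
      have h4 := next _ (h2.trans h1)
      refine ⟨h3.symm.trans h4, ?_⟩
      rcases Nat.lt_or_ge (k + 1) j with hk | hk
      · exact ⟨k + 1, by omega, hk, h3⟩
      · obtain rfl : j = k + 1 := by omega
        exact ⟨i, le_rfl, hij, h.trans h3⟩
  simpa using (key t).1 0 hm

theorem eq_of_ne_of_ne {a b c : Fin 2} (h : a ≠ b) (h' : c ≠ b) : a = c := by omega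

theorem IsSturmian.false_of_palindrome {s : ℕ → Fin 2} (hs : IsSturmian s) {L i j : ℕ}
    (hij : s i ≠ s j) (hi : s (i + 1 + L) = s i) (hj : s (j + 1 + L) = s j)
    (hag : Agree s (i + 1) (j + 1) L)
    (hpal : ∀ t < L, s (i + 1 + t) = s (i + 1 + (L - 1 - t)))
    (hns : ¬ RightSpecial s i (L + 1)) : False := by
  have hsp : RightSpecial s (i + 1) L := ⟨j + 1, hag, by rwa [hi, hj]⟩
  have hnj : ∀ r ≤ L + 1, ¬ Agree s (i + r) j (L + 1) := by
    intro r hr h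
    rcases r with _ | r
    · exact hij (h 0 (by omega))
    · have h0 : s (i + (r + 1)) = s j := h 0 (by omega)
      rcases Nat.lt_or_ge r L with hrL | hrL
      · have h1 := h (L - r) (by omega)
        have h2 := hag (L - 1 - r) (by omega)
        rw [show i + (r + 1) + (L - r) = i + 1 + L by omega, hi,
          show j + (L - r) = j + 1 + (L - 1 - r) by omega, ← h2, ← hpal r hrL,
          show i + 1 + r = i + (r + 1) by omega, h0] at h1
        exact hij h1
      · rw [show i + (r + 1) = i + 1 + L by omega, hi] at h0
        exact hij h0
  have hnsp : ∀ r ≤ L + 1, ¬ RightSpecial s (i + r) (L + 1) := by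
    intro r hr h
    have h1 := hs.rightSpecial_unique h.tail hsp
    by_cases hri : s (i + r) = s i
    · exact hns (h.congr (h1.cons hri))
    · exact hnj r hr ((h1.trans hag).cons (eq_of_ne_of_ne hri hij.symm))
  have hmaps : (fun r => factorAt s (i + r) (L + 1)) '' (Finset.range (L + 2) : Set ℕ) ⊆
      factors s (L + 1) \ {factorAt s j (L + 1)} := by
    rintro _ ⟨r, hr, rfl⟩
    refine ⟨⟨i + r, rfl⟩, fun h => hnj r ?_ (factorAt_eq_iff.1 h)⟩
    have := Finset.mem_range.1 (Finset.mem_coe.1 hr)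
    omega
  have h1 := Set.ncard_le_ncard hmaps (finite_factors s _).sdiff
  rw [Set.ncard_sdiff_singleton_of_mem (show factorAt s j (L + 1) ∈ factors s (L + 1) from ⟨j, rfl⟩)] at h1
  have h2 : (factors s (L + 1)).ncard = L + 1 + 1 := hs (L + 1)
  have hninj : ¬ Set.InjOn (fun r => factorAt s (i + r) (L + 1)) (Finset.range (L + 2)) := by
    intro hinj
    rw [hinj.ncard_image, Set.ncard_coe_finset, Finset.card_range] at h1
    omega
  have hrep : ∃ r r', r < r' ∧ r' ≤ L + 1 ∧ Agree s (i + r) (i + r') (L + 1) := by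
    simp only [Set.InjOn, not_forall] at hninj
    obtain ⟨r, hr, r', hr', he, hne⟩ := hninj
    have hr := Finset.mem_range.1 (Finset.mem_coe.1 hr)
    have hr' := Finset.mem_range.1 (Finset.mem_coe.1 hr')
    rcases Nat.lt_or_gt_of_ne hne with h | h
    · exact ⟨r, r', h, by omega, factorAt_eq_iff.1 he⟩
    · exact ⟨r', r, h, by omega, factorAt_eq_iff.1 he.symm⟩
  obtain ⟨r, r', hlt, hle, hrr⟩ := hrep
  have hper := eventually_periodic_of_not_rightSpecial (by omega) (by omega) hrr
    fun k hk hk' => by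
      have := hnsp (k - i) (by omega)
      rwa [Nat.add_sub_cancel' (by omega)] at this
  obtain ⟨k, hk, hne⟩ := hs.not_eventually_periodic (n := r' - r) (by omega) (i + r)
  refine hne ?_
  have := hper (k - (i + r))
  rw [show i + r + (k - (i + r)) = k by omega,
    show i + r' + (k - (i + r)) = k + (r' - r) by omega] at this
  exact this.symm

/-- The number of letters `1` in a factor. -/
def ones (x : ℕ → Fin 2) (i n : ℕ) : ℤ := ∑ t ∈ Finset.range n, ((x (i + t) : ℕ) : ℤ)

theorem ones_succ (x : ℕ → Fin 2) (i n : ℕ) :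
    ones x i (n + 1) = ones x i n + (x (i + n) : ℕ) := Finset.sum_range_succ _ _

theorem ones_add (x : ℕ → Fin 2) (i m n : ℕ) :
    ones x i (m + n) = ones x i m + ones x (i + m) n := by
  simp [ones, Finset.sum_range_add, Nat.add_assoc]

theorem ones_succ' (x : ℕ → Fin 2) (i n : ℕ) :
    ones x i (n + 1) = (x i : ℕ) + ones x (i + 1) n := by
  rw [Nat.add_comm, ones_add]; simp [ones]

theorem ones_congr {x : ℕ → Fin 2} {i j n : ℕ} (h : Agree x i j n) : ones x i n = ones x j n :=
  Finset.sum_congr rfl fun t ht => by rw [h t (Finset.mem_range.1 ht)]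

/-- Sturmian words are balanced. -/
theorem IsSturmian.balanced {s : ℕ → Fin 2} (hs : IsSturmian s) (n i j : ℕ) :
    ones s i n - ones s j n ≤ 1 := by
  induction n using Nat.strong_induction_on generalizing i j with
  | _ n ih =>
  by_contra! hn
  have lt : ∀ k, ((s k : ℕ) : ℤ) ≤ 1 ∧ 0 ≤ ((s k : ℕ) : ℤ) := fun k => by
    have := (s k).isLt; omega
  have ext : ∀ k l, ((s k : ℕ) : ℤ) = (s l : ℕ) → s k = s l := fun k l h =>
    Fin.ext (by exact_mod_cast h)
  obtain ⟨L, rfl⟩ : ∃ L, n = L + 2 := by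
    rcases n with _ | _ | L
    · simp [ones] at hn
    · have := lt i; have := lt j
      simp only [ones_succ] at hn; simp [ones] at hn; omega
    · exact ⟨L, rfl⟩
  have hD : ∀ m ≤ L, ones s i (m + 1) - ones s j (m + 1) = 1 ∧
      ones s i (L + 2) - ones s j (L + 2) = 2 := by
    intro m hm
    have h1 := ih (m + 1) (by omega) i j
    have h2 := ih (L + 1 - m) (by omega) (i + (m + 1)) (j + (m + 1))
    have h3 := ones_add s i (m + 1) (L + 1 - m)
    have h4 := ones_add s j (m + 1) (L + 1 - m)
    rw [show m + 1 + (L + 1 - m) = L + 2 by omega] at h3 h4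
    omega
  have hfirst : ((s i : ℕ) : ℤ) = 1 ∧ ((s j : ℕ) : ℤ) = 0 := by
    have h := (hD 0 (by omega)).1
    have := lt i; have := lt j
    simp [ones] at h; omega
  have hlast : ((s (i + 1 + L) : ℕ) : ℤ) = 1 ∧ ((s (j + 1 + L) : ℕ) : ℤ) = 0 := by
    have h := hD L le_rfl
    rw [ones_succ s i (L + 1), ones_succ s j (L + 1)] at h
    have := lt (i + 1 + L); have := lt (j + 1 + L)
    rw [Nat.add_right_comm i, Nat.add_right_comm j, Nat.add_assoc i, Nat.add_assoc j] at *
    omega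
  have hag : Agree s (i + 1) (j + 1) L := by
    intro t ht
    have h1 := (hD t (by omega)).1
    have h2 := (hD (t + 1) (by omega)).1
    rw [ones_succ s i (t + 1), ones_succ s j (t + 1)] at h2
    rw [Nat.add_right_comm i, Nat.add_right_comm j, Nat.add_assoc i, Nat.add_assoc j]
    exact ext _ _ (by omega)
  have hrev : ∀ m ≤ L, ones s (i + 1) m = ones s (i + 1 + (L - m)) m ∧
      ∀ t < m, s (i + 1 + t) = s (i + 1 + (L - 1 - t)) := by
    intro m hm
    induction m with
    | zero => simp [ones]
    | succ m ihm =>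
      obtain ⟨h1, h2⟩ := ihm (by omega)
      have hj1 := ones_congr (hag.mono (by omega : m ≤ L))
      have hag' : Agree s (i + 1 + (L - m)) (j + 1 + (L - m)) m := fun t ht => by
        have := hag (L - m + t) (by omega)
        rwa [← Nat.add_assoc, ← Nat.add_assoc (j + 1)] at this
      have hj2 := ones_congr hag'
      have hm1 := hag m (by omega)
      have hm2 := hag (L - 1 - m) (by omega)
      have e : ∀ k, k + 1 + (L - (m + 1)) + 1 = k + 1 + (L - m) := fun k => by omega
      have e1 : ∀ k, k + 1 + (L - (m + 1)) + (m + 1) = k + 1 + L := fun k => by omega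
      have e2 : ∀ k, k + 1 + (L - (m + 1)) = k + 1 + (L - 1 - m) := fun k => by omega
      have e3 : ∀ k, k + (m + 1) = k + 1 + m := fun k => by omega
      have hA := ih (m + 2) (by omega) i (j + 1 + (L - (m + 1)))
      have hB := ih (m + 2) (by omega) (i + 1 + (L - (m + 1))) j
      rw [ones_succ, ones_succ', ones_succ, ones_succ', e, e1, e2, e3, ← hm2, ← hj2] at hA
      rw [ones_succ, ones_succ', ones_succ, ones_succ', e, e1, e2, e3, ← hm1, ← hj1] at hB
      have hw : s (i + 1 + m) = s (i + 1 + (L - 1 - m)) := by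
        have := lt (i + 1 + m); have := lt (i + 1 + (L - 1 - m))
        exact ext _ _ (by omega)
      refine ⟨?_, fun t ht => ?_⟩
      · rw [ones_succ, ones_succ', e, e2, h1, hw]; ring
      · rcases Nat.lt_succ_iff_lt_or_eq.1 ht with ht | rfl
        exacts [h2 t ht, hw]
  have hpal := (hrev L le_rfl).2
  have hij : s i ≠ s j := fun h => by rw [h] at hfirst; omega
  by_cases hsp : RightSpecial s i (L + 1)
  · refine hs.false_of_palindrome hij.symm (ext _ _ (by omega)) (ext _ _ (by omega)) hag.symm ?_
      fun h => hij (hs.rightSpecial_unique hsp h 0 (by omega))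
    intro t ht
    rw [← hag t ht, ← hag _ (by omega), hpal t ht]
  · exact hs.false_of_palindrome hij (ext _ _ (by omega)) (ext _ _ (by omega)) hag hpal hsp

theorem signSum_factorAt (x : ℕ → Fin 2) (i n : ℕ) :
    signSum (factorAt x i n) = 2 * ones x i n - n := by
  induction n with
  | zero => simp [factorAt, signSum, signPoly, ones]
  | succ n ih =>
    rw [factorAt_succ, signSum_append, ih, signSum_singleton, ones_succ, letterSign]
    push_cast; ring

theorem signMoment_factorAt (x : ℕ → Fin 2) (i n : ℕ) :
    signMoment (factorAt x i n) = ∑ m ∈ Finset.range n, signSum (factorAt x i m) := by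
  induction n with
  | zero => simp [factorAt, signMoment, signPoly]
  | succ n ih =>
    rw [factorAt_succ, signMoment_append, ih, signMoment_singleton, Finset.sum_range_succ]
    simp; ring

theorem IsSturmian.separated {s : ℕ → Fin 2} (hs : IsSturmian s) : Separated 2 s := by
  intro n i j h
  have h1 := h.signSum_eq
  have h2 := h.signMoment_eq
  rw [signSum_factorAt, signSum_factorAt] at h1
  simp only [signMoment_factorAt, signSum_factorAt] at h2
  have hsum : ∑ m ∈ Finset.range n, (ones s i m - ones s j m) = 0 := by
    rw [← sub_eq_zero, ← Finset.sum_sub_distrib] at h2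
    have : ∑ m ∈ Finset.range n, 2 * (ones s i m - ones s j m) = 0 := by
      rw [← h2]; exact Finset.sum_congr rfl fun _ _ => by ring
    rw [← Finset.mul_sum] at this
    omega
  have hpair : ∀ p q m l, m ≤ l → (ones s p m - ones s q m) - (ones s p l - ones s q l) ≤ 1 := by
    intro p q m l hml
    obtain ⟨d, rfl⟩ := Nat.exists_eq_add_of_le hml
    rw [ones_add, ones_add]
    linarith [hs.balanced d (q + m) (p + m)]
  have hzero : ∀ m < n, ones s i m - ones s j m = 0 := by
    intro m hm
    by_contra hne
    rcases lt_or_gt_of_ne hne with hneg | hpos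
    · have : ∑ l ∈ Finset.range n, (ones s i l - ones s j l) < 0 :=
        Finset.sum_neg' (fun l _ => by
          rcases le_total l m with hl | hl
          · have := hpair i j l m hl; omega
          · have := hpair j i m l hl; omega) ⟨m, Finset.mem_range.2 hm, hneg⟩
      omega
    · have : 0 < ∑ l ∈ Finset.range n, (ones s i l - ones s j l) :=
        Finset.sum_pos' (fun l _ => by
          rcases le_total l m with hl | hl
          · have := hpair j i l m hl; omega
          · have := hpair i j m l hl; omega) ⟨m, Finset.mem_range.2 hm, hpos⟩
      omega
  have hzero' : ∀ m ≤ n, ones s i m - ones s j m = 0 := by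
    intro m hm
    rcases hm.lt_or_eq with hm | rfl
    · exact hzero m hm
    · omega
  refine factorAt_eq_iff.2 fun t ht => Fin.ext ?_
  have h3 := hzero' t (by omega)
  have h4 := hzero' (t + 1) (by omega)
  rw [ones_succ, ones_succ] at h4
  omega

theorem binomial_one_of_signSum_eq {u v : List (Fin 2)} (hl : u.length = v.length)
    (h : signSum u = signSum v) : binomialSetoid (Fin 2) 1 u v := by
  have key : ∀ (b : Fin 2) (u : List (Fin 2)),
      2 * (binom u [b] : ℤ) = u.length + letterSign b * signSum u := by
    intro b u
    induction u with
    | nil => simp [binom_nil_cons, signSum, signPoly]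
    | cons a u ih =>
      rw [binom_cons_cons, signSum_cons, binom_nil_right]
      push_cast
      rw [mul_add, ih]
      fin_cases a <;> fin_cases b <;> simp [letterSign] <;> ring
  intro w hw
  match w with
  | [] => rw [binom_nil_right, binom_nil_right]
  | [b] =>
    have h1 := key b u
    have h2 := key b v
    rw [hl, h] at h1
    omega
  | _ :: _ :: _ => simp at hw

/-- In a Sturmian word, there are two abelian equivalent factors of each length `n ≥ 2`. -/
theorem IsSturmian.splitsAt_one {s : ℕ → Fin 2} (hs : IsSturmian s) : SplitsAt 1 s := by
  intro N
  refine ⟨N + 2, by omega, ?_⟩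
  have hninj : ¬ Set.InjOn signSum (factors s (N + 2)) := by
    intro hinj
    obtain ⟨c, hc⟩ : ∃ c, ∀ i, ones s i (N + 2) = c ∨ ones s i (N + 2) = c + 1 := by
      by_cases h : ∃ i, ones s i (N + 2) < ones s 0 (N + 2)
      · obtain ⟨i, hi⟩ := h
        refine ⟨ones s i (N + 2), fun k => ?_⟩
        have := hs.balanced (N + 2) 0 i
        have := hs.balanced (N + 2) k i
        have := hs.balanced (N + 2) 0 k
        omega
      · push Not at h
        refine ⟨ones s 0 (N + 2), fun k => ?_⟩
        have := hs.balanced (N + 2) k 0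
        have := h k
        omega
    have hsub : signSum '' factors s (N + 2) ⊆
        {2 * c - (N + 2 : ℕ), 2 * (c + 1) - (N + 2 : ℕ)} := by
      rintro _ ⟨_, ⟨i, rfl⟩, rfl⟩
      rw [signSum_factorAt]
      rcases hc i with h | h <;> simp [h]
    have h1 := Set.ncard_le_ncard hsub (Set.toFinite _)
    have h2 := Set.ncard_insert_le (2 * c - (N + 2 : ℕ)) {2 * (c + 1) - ((N + 2 : ℕ) : ℤ)}
    rw [Set.ncard_singleton] at h2
    have h3 : (factors s (N + 2)).ncard = N + 2 + 1 := hs _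
    rw [hinj.ncard_image] at h1
    omega
  simp only [Set.InjOn, not_forall] at hninj
  obtain ⟨_, ⟨i, rfl⟩, _, ⟨j, rfl⟩, he, hne⟩ := hninj
  exact ⟨i, j, binomial_one_of_signSum_eq (by simp [length_factorAt]) he,
    fun h => hne (hs.separated _ _ _ h)⟩

theorem IsSturmian.complexityChain {s : ℕ → Fin 2} (hs : IsSturmian s) (k : ℕ) :
    ComplexityChain (k + 2) (thueMorseIterate k s) :=
  complexityChain_thueMorseIterate hs.nonperiodic hs.splitsAt_one hs.separated k


theorem getElem?_limitWord {A : Type*} {f : A → List A} {a : A} (h : Prolongable f a) {m n : ℕ}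
    (hn : n < ((mapWord f)^[m] [a]).length) : ((mapWord f)^[m] [a])[n]? = limitWord f a n := by
  have := congrArg (fun l => l[n]?) (prefix_limitWord h m)
  simpa [factorAt, hn] using this

/-! ### The Fibonacci word -/

theorem prolongable_fibonacci : Prolongable fibonacci 0 := by
  refine ⟨[1], rfl, fun n => ?_⟩
  have hne : ∀ u, u ≠ [] → mapWord fibonacci u ≠ [] := by
    intro u hu
    have := le_length_mapWord (f := fibonacci) (by decide) u
    rw [← List.length_pos_iff] at hu ⊢
    omega
  induction n with
  | zero => simp
  | succ n ih => rw [Function.iterate_succ_apply']; exact hne _ ih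

/-- The length of the Fibonacci image of the prefix of length `n` of the Fibonacci word. -/
def fibPos : ℕ → ℕ
  | 0 => 0
  | n + 1 => fibPos n + if fibonacciWord n = 0 then 2 else 1

theorem fibPos_succ_of_zero {n : ℕ} (h : fibonacciWord n = 0) : fibPos (n + 1) = fibPos n + 2 := by
  simp [fibPos, h]

theorem fibPos_succ_of_ne {n : ℕ} (h : fibonacciWord n ≠ 0) : fibPos (n + 1) = fibPos n + 1 := by
  simp [fibPos, h]

theorem le_fibPos (n : ℕ) : n ≤ fibPos n := by
  induction n with
  | zero => exact le_rfl
  | succ n ih => rw [fibPos]; split_ifs <;> omega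

theorem mapWord_fibonacci_prefix (n : ℕ) :
    mapWord fibonacci (factorAt fibonacciWord 0 n) = factorAt fibonacciWord 0 (fibPos n) := by
  have hlen : (mapWord fibonacci (factorAt fibonacciWord 0 n)).length = fibPos n := by
    induction n with
    | zero => rfl
    | succ n ih =>
      rw [factorAt_succ, mapWord_append, List.length_append, ih, fibPos, Nat.zero_add]
      congr 1
      generalize fibonacciWord n = a
      fin_cases a <;> rfl
  have hlt := lt_length_iterate prolongable_fibonacci n
  obtain ⟨d, hd⟩ := Nat.exists_eq_add_of_lt hlt
  have h1 := prefix_limitWord prolongable_fibonacci (n + 1)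
  have hf : limitWord fibonacci 0 = fibonacciWord := rfl
  rw [Function.iterate_succ_apply', prefix_limitWord prolongable_fibonacci n, hd, Nat.add_assoc,
    factorAt_add, mapWord_append, hf] at h1
  rw [List.length_append, hlen, factorAt_add _ _ (fibPos n)] at h1
  exact (List.append_inj h1 (by rw [hlen, length_factorAt])).1

theorem factorAt_fibPos (n : ℕ) :
    factorAt fibonacciWord (fibPos n) (fibPos (n + 1) - fibPos n) = fibonacci (fibonacciWord n) := by
  have h := mapWord_fibonacci_prefix (n + 1)
  have hle : fibPos n ≤ fibPos (n + 1) := Nat.le_add_right _ _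
  rw [factorAt_succ, mapWord_append, mapWord_fibonacci_prefix, Nat.zero_add,
    ← Nat.add_sub_cancel' hle, factorAt_add, List.append_cancel_left_eq, Nat.zero_add] at h
  rw [← h]; simp [mapWord]

theorem fibonacciWord_fibPos (n : ℕ) : fibonacciWord (fibPos n) = 0 := by
  have h := factorAt_fibPos n
  by_cases hn : fibonacciWord n = 0
  · rw [fibPos_succ_of_zero hn, Nat.add_sub_cancel_left, hn] at h
    simpa [factorAt, List.range_succ, fibonacci] using (List.cons.inj h).1
  · rw [fibPos_succ_of_ne hn, Nat.add_sub_cancel_left, Fin.eq_one_of_ne_zero _ hn] at h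
    simpa [factorAt, List.range_succ, fibonacci] using (List.cons.inj h).1

theorem fibonacciWord_fibPos_add_one {n : ℕ} (hn : fibonacciWord n = 0) :
    fibonacciWord (fibPos n + 1) = 1 := by
  have h := factorAt_fibPos n
  rw [fibPos_succ_of_zero hn, Nat.add_sub_cancel_left, hn] at h
  simpa [factorAt, List.range_succ, fibonacci] using (List.cons.inj (List.cons.inj h).2).1

theorem fibonacciWord_fibPos_add_one_iff (n : ℕ) :
    fibonacciWord (fibPos n + 1) = 1 ↔ fibonacciWord n = 0 := by
  refine ⟨fun h => ?_, fibonacciWord_fibPos_add_one⟩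
  by_contra hn
  rw [← fibPos_succ_of_ne hn, fibonacciWord_fibPos] at h
  exact absurd h (by decide)

theorem eq_fibPos_or (i : ℕ) :
    ∃ q, i = fibPos q ∨ (i = fibPos q + 1 ∧ fibonacciWord q = 0) := by
  induction i with
  | zero => exact ⟨0, Or.inl rfl⟩
  | succ i ih =>
    obtain ⟨q, rfl | ⟨rfl, hq⟩⟩ := ih
    · by_cases hq : fibonacciWord q = 0
      · exact ⟨q, Or.inr ⟨rfl, hq⟩⟩
      · exact ⟨q + 1, Or.inl (fibPos_succ_of_ne hq).symm⟩
    · exact ⟨q + 1, Or.inl (fibPos_succ_of_zero hq).symm⟩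

theorem exists_fibPos_of_eq_zero {i : ℕ} (h : fibonacciWord i = 0) : ∃ q, i = fibPos q := by
  obtain ⟨q, hq | ⟨rfl, hq⟩⟩ := eq_fibPos_or i
  · exact ⟨q, hq⟩
  · rw [fibonacciWord_fibPos_add_one hq] at h
    exact absurd h (by decide)

theorem fibonacciWord_succ_of_ne {i : ℕ} (h : fibonacciWord i ≠ 0) :
    fibonacciWord (i + 1) = 0 := by
  obtain ⟨q, rfl | ⟨rfl, hq⟩⟩ := eq_fibPos_or i
  · exact absurd (fibonacciWord_fibPos q) h
  · rw [Nat.add_assoc, ← fibPos_succ_of_zero hq, fibonacciWord_fibPos]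

/-- The letter before the image of the `(q + 1)`-st letter is the complement of the `q`-th. -/
theorem exists_pred_fibPos (q : ℕ) :
    ∃ p, fibPos (q + 1) = p + 1 ∧ fibonacciWord p = 1 - fibonacciWord q := by
  by_cases hq : fibonacciWord q = 0
  · exact ⟨fibPos q + 1, fibPos_succ_of_zero hq, by rw [fibonacciWord_fibPos_add_one hq, hq]; rfl⟩
  · exact ⟨fibPos q, fibPos_succ_of_ne hq,
      by rw [fibonacciWord_fibPos, Fin.eq_one_of_ne_zero _ hq]; rfl⟩

theorem fibPos_add {P m : ℕ} (h : Agree fibonacciWord P 0 m) :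
    fibPos (P + m) = fibPos P + fibPos m := by
  induction m with
  | zero => rfl
  | succ m ih =>
    have h1 := h m (by omega)
    rw [Nat.zero_add] at h1
    rw [← Nat.add_assoc, fibPos, fibPos, ih (h.mono (by omega)), h1]
    omega

theorem agree_fibPos {P m : ℕ} (h : Agree fibonacciWord P 0 m) :
    Agree fibonacciWord (fibPos P) 0 (fibPos m + 1) := by
  induction m with
  | zero =>
    intro t ht
    obtain rfl : t = 0 := by simp [fibPos] at ht; exact ht
    simpa [fibPos] using (fibonacciWord_fibPos P).trans (fibonacciWord_fibPos 0).symm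
  | succ m ih =>
    have hm := h.mono (Nat.le_succ m)
    have h1 := h m (by omega)
    rw [Nat.zero_add] at h1
    have hlast : fibonacciWord (fibPos P + fibPos (m + 1)) =
        fibonacciWord (0 + fibPos (m + 1)) := by
      rw [← fibPos_add h, Nat.zero_add, fibonacciWord_fibPos, fibonacciWord_fibPos]
    by_cases h0 : fibonacciWord m = 0
    · rw [fibPos_succ_of_zero h0] at hlast ⊢
      refine ((ih hm).succ ?_).succ hlast
      rw [← Nat.add_assoc, ← fibPos_add hm, Nat.zero_add, fibonacciWord_fibPos_add_one h0,
        fibonacciWord_fibPos_add_one (h1.trans h0)]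
    · rw [fibPos_succ_of_ne h0] at hlast ⊢
      exact (ih hm).succ hlast

/-- The left special factors of the Fibonacci word are prefixes. -/
theorem fibonacciWord_leftSpecial (n p q : ℕ) (hpq : fibonacciWord p ≠ fibonacciWord q)
    (h : Agree fibonacciWord (p + 1) (q + 1) n) : Agree fibonacciWord (p + 1) 0 n := by
  induction n using Nat.strong_induction_on generalizing p q with
  | _ n ih =>
  rcases Nat.eq_zero_or_pos n with rfl | hn
  · exact fun t ht => absurd ht (by omega)
  have h0 : fibonacciWord (p + 1) = fibonacciWord (q + 1) := h 0 hn
  have hp0 : fibonacciWord (p + 1) = 0 := by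
    by_cases hp : fibonacciWord p = 0
    · rw [h0]; exact fibonacciWord_succ_of_ne fun hq => hpq (hp.trans hq.symm)
    · exact fibonacciWord_succ_of_ne hp
  obtain ⟨P, hP⟩ := exists_fibPos_of_eq_zero hp0
  obtain ⟨Q, hQ⟩ := exists_fibPos_of_eq_zero (h0.symm.trans hp0)
  rcases P with _ | P
  · simp [fibPos] at hP
  rcases Q with _ | Q
  · simp [fibPos] at hQ
  have hPQ : fibonacciWord P ≠ fibonacciWord Q := by
    obtain ⟨p', hp', hp⟩ := exists_pred_fibPos P
    obtain ⟨q', hq', hq⟩ := exists_pred_fibPos Q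
    obtain rfl : p = p' := by omega
    obtain rfl : q = q' := by omega
    intro he
    exact hpq (by rw [hp, hq, he])
  have key : ∀ m, (∀ t < m, fibPos t + 1 < n) →
      Agree fibonacciWord (P + 1) (Q + 1) m ∧ Agree fibonacciWord (P + 1) 0 m := by
    intro m
    induction m with
    | zero => exact fun _ => ⟨fun t ht => absurd ht (by omega), fun t ht => absurd ht (by omega)⟩
    | succ m ihm =>
      intro hm
      obtain ⟨h1, h2⟩ := ihm fun t ht => hm t (by omega)
      have hmn := hm m (by omega)
      have h3 := h (fibPos m + 1) hmn
      rw [hP, hQ, ← Nat.add_assoc, ← Nat.add_assoc, ← fibPos_add h2,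
        ← fibPos_add (h1.symm.trans h2)] at h3
      have h4 : fibonacciWord (P + 1 + m) = fibonacciWord (Q + 1 + m) := by
        have hi := fibonacciWord_fibPos_add_one_iff (P + 1 + m)
        rw [h3, fibonacciWord_fibPos_add_one_iff] at hi
        by_cases hz : fibonacciWord (P + 1 + m) = 0
        · exact hz.trans (hi.2 hz).symm
        · exact eq_of_ne_of_ne hz fun hz' => hz (hi.1 hz')
      have h5 := h1.succ h4
      have := le_fibPos m
      exact ⟨h5, ih (m + 1) (by omega) P Q hPQ h5⟩
  have mono : ∀ {t m}, t < m → fibPos t + 1 ≤ fibPos m := by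
    intro t m htm
    induction m with
    | zero => omega
    | succ m ihm =>
      have : fibPos m + 1 ≤ fibPos (m + 1) := by rw [fibPos]; split_ifs <;> omega
      rcases Nat.lt_succ_iff_lt_or_eq.1 htm with ht | rfl
      · have := ihm ht; omega
      · exact this
  intro s hs
  rw [hP]
  obtain ⟨m, rfl | ⟨rfl, -⟩⟩ := eq_fibPos_or s
  · exact agree_fibPos (key m fun t ht => (mono ht).trans_lt hs).2 _ (by omega)
  · have h1 := (key (m + 1) fun t ht => lt_of_le_of_lt (by
      rcases Nat.lt_succ_iff_lt_or_eq.1 ht with ht | rfl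
      · have := mono ht; omega
      · exact le_rfl) hs).2
    exact agree_fibPos h1 _ (by have := mono (Nat.lt_add_one m); omega)

theorem fibonacciWord_prefix_leftExtension (n : ℕ) (a : Fin 2) :
    ∃ p, fibonacciWord p = a ∧ Agree fibonacciWord (p + 1) 0 n := by
  induction n generalizing a with
  | zero =>
    have h0 : fibonacciWord 0 = 0 := rfl
    have h1 : fibonacciWord 1 = 1 := fibonacciWord_fibPos_add_one h0
    fin_cases a
    · exact ⟨0, h0, fun t ht => absurd ht (by omega)⟩
    · exact ⟨1, h1, fun t ht => absurd ht (by omega)⟩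
  | succ n ih =>
    obtain ⟨q, hq, h⟩ := ih (1 - a)
    obtain ⟨p, hp, hp'⟩ := exists_pred_fibPos q
    refine ⟨p, by rw [hp', hq, sub_sub_cancel], ?_⟩
    rw [← hp]
    exact (agree_fibPos h).mono (by have := le_fibPos n; omega)

theorem isSturmian_fibonacciWord : IsSturmian fibonacciWord := by
  intro n
  induction n with
  | zero =>
    have : factors fibonacciWord 0 = {[]} := by simp [factors, factorAt]
    rw [factorComplexity, this, Set.ncard_singleton]
  | succ n ih =>
    set x := fibonacciWord with hx
    obtain ⟨p₁, hp₁, h₁⟩ := fibonacciWord_prefix_leftExtension n 1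
    obtain ⟨p₀, hp₀, h₀⟩ := fibonacciWord_prefix_leftExtension n 0
    have htail : ∀ i, (factorAt x i (n + 1)).tail = factorAt x (i + 1) n := fun i => by
      rw [factorAt_succ', List.tail_cons]
    set w := factorAt x p₁ (n + 1) with hw
    have hinj : Set.InjOn List.tail (factors x (n + 1) \ {w}) := by
      rintro _ ⟨⟨i, rfl⟩, hi⟩ _ ⟨⟨j, rfl⟩, hj⟩ hij
      dsimp only at hij
      rw [htail, htail, factorAt_eq_iff] at hij
      by_cases hne : x i = x j
      · exact factorAt_eq_iff.2 (Agree.cons hij hne)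
      · exfalso
        have hi' := fibonacciWord_leftSpecial n i j hne hij
        have hj' := fibonacciWord_leftSpecial n j i (Ne.symm hne) (Agree.symm hij)
        by_cases hi1 : x i = 1
        · exact hi (factorAt_eq_iff.2 ((hi'.trans h₁.symm).cons (hi1.trans hp₁.symm)))
        · refine hj (factorAt_eq_iff.2 ((hj'.trans h₁.symm).cons (Eq.trans ?_ hp₁.symm)))
          by_contra hj1
          exact hne (eq_of_ne_of_ne hi1 hj1)
    have himage : List.tail '' (factors x (n + 1) \ {w}) = factors x n := by
      refine Set.Subset.antisymm ?_ ?_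
      · rintro _ ⟨_, ⟨⟨i, rfl⟩, -⟩, rfl⟩
        exact ⟨i + 1, (htail i).symm⟩
      · have hprefix : factorAt x 0 n ∈ List.tail '' (factors x (n + 1) \ {w}) := by
          refine ⟨_, ⟨⟨p₀, rfl⟩, fun h => ?_⟩, (htail p₀).trans (factorAt_eq_iff.2 h₀)⟩
          have h2 : x p₀ = x p₁ := factorAt_eq_iff.1 h 0 (by omega)
          rw [hx, hp₀, hp₁] at h2
          exact absurd h2 (by decide)
        rintro _ ⟨i, rfl⟩
        rcases i with _ | i
        · exact hprefix
        · by_cases hi : factorAt x i (n + 1) = w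
          · have h2 : factorAt x (i + 1) n = factorAt x 0 n := by
              rw [← htail, hi, hw, htail]; exact factorAt_eq_iff.2 h₁
            change factorAt x (i + 1) n ∈ _
            rw [h2]; exact hprefix
          · exact ⟨_, ⟨⟨i, rfl⟩, hi⟩, htail i⟩
    have h2 := Set.ncard_sdiff_singleton_add_one (show w ∈ factors x (n + 1) from ⟨p₁, rfl⟩)
      (finite_factors x (n + 1))
    rw [← hinj.ncard_image, himage] at h2
    exact h2.symm.trans (congrArg (· + 1) ih)

/-! ### Morphic words -/

/-- A morphic word with a non-erasing morphism. -/
def IsNonerasingMorphic {B : Type*} (x : ℕ → B) : Prop :=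
  ∃ (A : Type) (_ : Fintype A) (f : A → List A) (a : A) (τ : A → B),
    (∀ b, f b ≠ []) ∧ (∃ u, u ≠ [] ∧ f a = a :: u) ∧ x = fun n => τ (limitWord f a n)

theorem prolongable_of_nonerasing {A : Type*} {f : A → List A} {a : A} (hf : ∀ b, f b ≠ [])
    (h : ∃ u, u ≠ [] ∧ f a = a :: u) : Prolongable f a := by
  obtain ⟨u, hu, ha⟩ := h
  refine ⟨u, ha, fun n => ?_⟩
  induction n with
  | zero => exact hu
  | succ n ih =>
    rw [Function.iterate_succ_apply']
    have := le_length_mapWord hf ((mapWord f)^[n] u)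
    rw [← List.length_pos_iff] at ih ⊢
    omega

theorem IsNonerasingMorphic.isMorphic {B : Type*} {x : ℕ → B} (h : IsNonerasingMorphic x) :
    IsMorphic x := by
  obtain ⟨A, i, f, a, τ, hf, ha, hx⟩ := h
  exact ⟨A, i, f, a, τ, prolongable_of_nonerasing hf ha, hx⟩

/-- The morphism that doubles letters, keeping track of the copy. -/
def double {A : Type*} (b : A) : List (A × Fin 2) := [(b, 0), (b, 1)]

theorem length_mapWord_double {A : Type*} (u : List A) :
    (mapWord double u).length = 2 * u.length := by
  induction u with
  | nil => rfl
  | cons a u ih =>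
    simp only [mapWord, List.flatMap_cons, List.length_append, List.length_cons] at ih ⊢
    rw [ih]; simp [double]; ring

theorem getElem?_mapWord_double {A : Type*} (u : List A) (q : ℕ) :
    (mapWord double u)[2 * q]? = u[q]?.map (·, 0) ∧
      (mapWord double u)[2 * q + 1]? = u[q]?.map (·, 1) := by
  induction u generalizing q with
  | nil => simp [mapWord]
  | cons a u ih =>
    have e : mapWord double (a :: u) = (a, 0) :: (a, 1) :: mapWord double u := rfl
    rw [e]
    cases q with
    | zero => simp
    | succ q => simpa [Nat.mul_succ] using ih q

/-- The morphism on doubled letters induced by `f`: the double of `f b` is split in its middle. -/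
def doubleMorphism {A : Type*} (f : A → List A) (c : A × Fin 2) : List (A × Fin 2) :=
  if c.2 = 0 then (mapWord double (f c.1)).take (f c.1).length
  else (mapWord double (f c.1)).drop (f c.1).length

theorem mapWord_doubleMorphism {A : Type*} (f : A → List A) (u : List A) :
    mapWord (doubleMorphism f) (mapWord double u) = mapWord double (mapWord f u) := by
  induction u with
  | nil => rfl
  | cons a u ih =>
    have e : mapWord double (a :: u) = [(a, 0), (a, 1)] ++ mapWord double u := rfl
    have e' : mapWord f (a :: u) = f a ++ mapWord f u := rfl
    rw [e, e', mapWord_append, mapWord_append, ih]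
    simp [mapWord, doubleMorphism]

theorem iterate_doubleMorphism {A : Type*} (f : A → List A) (n : ℕ) (u : List A) :
    (mapWord (doubleMorphism f))^[n] (mapWord double u) = mapWord double ((mapWord f)^[n] u) := by
  induction n with
  | zero => rfl
  | succ n ih =>
    rw [Function.iterate_succ_apply', Function.iterate_succ_apply', ih, mapWord_doubleMorphism]

theorem doubleMorphism_ne_nil {A : Type*} {f : A → List A} (hf : ∀ b, f b ≠ [])
    (c : A × Fin 2) : doubleMorphism f c ≠ [] := by
  have h1 := List.length_pos_iff.2 (hf c.1)
  have h2 := length_mapWord_double (f c.1)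
  rw [← List.length_pos_iff, doubleMorphism]
  split_ifs <;> simp only [List.length_take, List.length_drop] <;> omega

theorem IsNonerasingMorphic.image_thueMorse {x : ℕ → Fin 2} (h : IsNonerasingMorphic x) :
    IsNonerasingMorphic (image thueMorse x) := by
  obtain ⟨A, _, f, a, τ, hf, ha, rfl⟩ := h
  have hp := prolongable_of_nonerasing hf ha
  have ha' : ∃ u, u ≠ [] ∧ doubleMorphism f (a, 0) = (a, 0) :: u := by
    obtain ⟨u, hu, h⟩ := ha
    obtain ⟨b, v, rfl⟩ := List.exists_cons_of_ne_nil hu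
    refine ⟨((a, 1) :: mapWord double (b :: v)).take (b :: v).length, by simp, ?_⟩
    simp [doubleMorphism, h, mapWord, double]
  have hf' := doubleMorphism_ne_nil hf
  have hp' := prolongable_of_nonerasing hf' ha'
  refine ⟨A × Fin 2, inferInstance, doubleMorphism f, (a, 0),
    fun c => if c.2 = 0 then τ c.1 else 1 - τ c.1, hf', ha', ?_⟩
  have key : ∀ n, (mapWord double ((mapWord f)^[n] [a]))[n]? =
      some (limitWord (doubleMorphism f) (a, 0) n) := by
    intro n
    have hlt := lt_length_iterate hp' n
    rw [← iterate_doubleMorphism]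
    have e : mapWord double [a] = [(a, 0)] ++ [(a, 1)] := rfl
    rw [e, iterate_mapWord_append, List.getElem?_append_left hlt, getElem?_limitWord hp' hlt]
  have hbound : ∀ q m, q ≤ m → ((mapWord f)^[m] [a])[q]? = some (limitWord f a q) := fun q m hq =>
    getElem?_limitWord hp (hq.trans_lt (lt_length_iterate hp m))
  funext n
  have hn := key n
  rcases Nat.even_or_odd' n with ⟨q, rfl | rfl⟩
  · rw [(getElem?_mapWord_double _ q).1, hbound q _ (by omega)] at hn
    rw [image_thueMorse_even, ← Option.some_injective _ hn]
    simp
  · rw [(getElem?_mapWord_double _ q).2, hbound q _ (by omega)] at hn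
    rw [image_thueMorse_odd, ← Option.some_injective _ hn]
    simp

theorem isMorphic_thueMorseIterate_fibonacciWord (k : ℕ) :
    IsMorphic (thueMorseIterate k fibonacciWord) := by
  refine IsNonerasingMorphic.isMorphic ?_
  induction k with
  | zero =>
    exact ⟨Fin 2, inferInstance, fibonacci, 0, id, by decide, ⟨[1], by decide, rfl⟩, rfl⟩
  | succ k ih =>
    rw [thueMorseIterate, Function.iterate_succ_apply']
    exact ih.image_thueMorse

theorem isMorphic_const : IsMorphic (fun _ : ℕ => (0 : Fin 2)) :=
  IsNonerasingMorphic.isMorphic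
    ⟨Unit, inferInstance, fun _ => [(), ()], (), fun _ => 0, by simp, ⟨[()], by simp, rfl⟩, rfl⟩

theorem complexityChain_one_const : ComplexityChain 1 (fun _ : ℕ => (0 : Fin 2)) := by
  refine ⟨fun j h1 h2 => absurd h1 (by omega), funext fun n => Set.InjOn.ncard_image ?_⟩
  rintro _ ⟨i, rfl⟩ _ ⟨j, rfl⟩ -
  rfl

end BinomialWords

theorem mainTheorem8 :
    (∀ s : ℕ → Fin 2, IsSturmian s → ∀ k : ℕ, ComplexityChain (k + 2) (thueMorseIterate k s)) ∧
    (IsSturmian fibonacciWord ∧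
      ∀ k : ℕ, IsMorphic (thueMorseIterate k fibonacciWord) ∧
        ComplexityChain (k + 2) (thueMorseIterate k fibonacciWord)) ∧
    (∀ l : ℕ, 1 ≤ l → ∃ w : ℕ → Fin 2, IsMorphic w ∧ ComplexityChain l w) := by
  refine ⟨fun s hs k => hs.complexityChain k, ⟨isSturmian_fibonacciWord, fun k =>
    ⟨isMorphic_thueMorseIterate_fibonacciWord k, isSturmian_fibonacciWord.complexityChain k⟩⟩,
    fun l hl => ?_⟩
  obtain rfl | ⟨k, rfl⟩ : l = 1 ∨ ∃ k, l = k + 2 := by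
    rcases l with _ | _ | k
    exacts [absurd hl (by omega), Or.inl rfl, Or.inr ⟨k, rfl⟩]
  · exact ⟨_, isMorphic_const, complexityChain_one_const⟩
  · exact ⟨_, isMorphic_thueMorseIterate_fibonacciWord k,
      isSturmian_fibonacciWord.complexityChain k⟩
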